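/- Let $a,\varepsilon_0,\varepsilon_1>0$. On $\mathbb R^6=\{(M,\alpha)\}$ put $$L=\tfrac12 M\cdot\alpha,\qquad H=\tfrac14(M_1^2+M_2^2+2M_3^2)+\varepsilon_1(\alpha_3M_2-\alpha_2M_3)-\varepsilon_0\alpha_1,$$ $$K=\Bigl[\tfrac14(M_1^2-M_2^2)+\varepsilon_1(\alpha_2M_3-\alpha_3M_2)-\varepsilon_1^2|\alpha|^2+\varepsilon_0\alpha_1\Bigr]^2+\Bigl[\tfrac12M_1M_2+\varepsilon_1(\alpha_3M_1-\alpha_1M_3)+\varepsilon_0\alpha_2\Bigr]^2,$$ let $P^5=\{|\alpha|^2=a^2\}$, and let $\Sigma\subset\mathbb R^3(h,\ell,k)$ be the bifurcation diagram of the momentum map $\mathcal F=H\times L\times K:P^5\to\mathbb R^3$, that is, the set of values of $\mathcal F$ at the points of $P^5$ where the rank of $d\mathcal F|_{TP^5}$ is less than $3$. Let $S(s)=P(s)\varphi(s)$ be the polynomial of the separated equations of the Kowalevski–Sokolov top, $$P(s)=[s-(h+\varepsilon_1^2a^2)]^2-k,$$ $$\varphi(s)=s^3-2hs^2+[(h+\varepsilon_1^2a^2)^2+a^2\varepsilon_0^2-4\varepsilon_1^2\ell^2-k]s-2\varepsilon_0^2\ell^2,$$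 and let $D$ be its discriminant set: the set of $(h,\ell,k)\in\mathbb R^3$ for which $S$ has a multiple complex root. Then: (1) $D=\Pi_1\cup\Pi_2\cup\Pi_3\cup\Pi_4$, where $$\Pi_1:\ k=0;\qquad \Pi_2:\ k=\frac1{4\varepsilon_1^4}\left[2\varepsilon_1^2(h+\varepsilon_1^2a^2)+\varepsilon_0^2\right]^2;\qquad \Pi_3:\ k=\frac{[a^2(h+\varepsilon_1^2a^2)-2\ell^2]^2}{a^4};$$ $$\Pi_4:\ \ell^2=\frac{(h-s)s^2}{\varepsilon_0^2},\quad k=\frac{4\varepsilon_1^2}{\varepsilon_0^2}s^3+\Bigl(3-\frac{4\varepsilon_1^2}{\varepsilon_0^2}h\Bigr)s^2-4hs+a^2\varepsilon_0^2+(h+\varepsilon_1^2a^2)^2\quad\text{for some } s\in\mathbb R.$$ (2) $\Sigma\subset D$, and $\Sigma$ is the part of $D$ that corresponds to real solutions: $\Sigma=\Pi_1^{\mathrm r}\cup\Pi_2^{\mathrm r}\cup\Pi_3^{\mathrm r}\cup\Pi_4^{\mathrm r}$. Here, for $i=1,2,3$, with $\Pi_i$ written as $\Phi_i(h,\ell,k)=0$,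 where $\Phi_i$ is $k$ minus the right-hand side above, $\Pi_i^{\mathrm r}$ is the set of points $p\in\Pi_i$ such that the system $\Phi_i\circ\mathcal F=0$, $d(\Phi_i\circ\mathcal F)|_{TP^5}=0$ has a real solution $x\in P^5$ with $\mathcal F(x)=p$. The set $\Pi_4^{\mathrm r}$ is defined in the same way with the tangent plane of $\Pi_4$: it consists of the points $p=(h,\ell,k)\in\Pi_4$ for which there are $x\in P^5$ with $\mathcal F(x)=p$ and real $s,t$ such that $\ell=ts$, $h-s=\varepsilon_0^2t^2$, $k$ is given by the formula for $\Pi_4$ with this $s$, and $$dK-2(h+\varepsilon_1^2a^2-s)\,dH+4(\varepsilon_0^2+2\varepsilon_1^2s)\,t\,dL=0\quad\text{on } T_xP^5 .$$ -/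

import Mathlib

open Polynomial

noncomputable section

namespace KowalevskiSokolov

/-- The space `ℝ⁶(M, α)`: `x.1` is the angular momentum `M`, `x.2` the vector `α`. -/
abbrev Phase : Type := (Fin 3 → ℝ) × (Fin 3 → ℝ)

/-- The Casimir function `Γ = α²`. -/
def Gam (x : Phase) : ℝ := x.2 0 ^ 2 + x.2 1 ^ 2 + x.2 2 ^ 2

/-- The Casimir function (area integral) `L = (M · α) / 2`. -/
def L (x : Phase) : ℝ := (x.1 0 * x.2 0 + x.1 1 * x.2 1 + x.1 2 * x.2 2) / 2

/-- The Hamiltonian. -/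
def H (ε₀ ε₁ : ℝ) (x : Phase) : ℝ :=
  (x.1 0 ^ 2 + x.1 1 ^ 2 + 2 * x.1 2 ^ 2) / 4
    + ε₁ * (x.2 2 * x.1 1 - x.2 1 * x.1 2) - ε₀ * x.2 0

/-- The additional first integral. -/
def K (ε₀ ε₁ : ℝ) (x : Phase) : ℝ :=
  ((x.1 0 ^ 2 - x.1 1 ^ 2) / 4 + ε₁ * (x.2 1 * x.1 2 - x.2 2 * x.1 1)
      - ε₁ ^ 2 * (x.2 0 ^ 2 + x.2 1 ^ 2 + x.2 2 ^ 2) + ε₀ * x.2 0) ^ 2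
    + (x.1 0 * x.1 1 / 2 + ε₁ * (x.2 2 * x.1 0 - x.2 0 * x.1 2) + ε₀ * x.2 1) ^ 2

/-- The five-dimensional manifold `P⁵ = {α² = a²}`. -/
def P5 (a : ℝ) : Set Phase := {x | Gam x = a ^ 2}

/-- The tangent space `T_x P⁵`, as the kernel of `dΓ(x)` (for `a ≠ 0`, `P⁵` is a regular level
of `Γ`). -/
def tangent (x : Phase) : Submodule ℝ Phase := LinearMap.ker (fderiv ℝ Gam x).toLinearMap

/-- The momentum map `H × L × K`, with values `(h, ℓ, k)`. -/
def momentum (ε₀ ε₁ : ℝ) (x : Phase) : ℝ × ℝ × ℝ := (H ε₀ ε₁ x, L x, K ε₀ ε₁ x)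

/-- The critical points of the momentum map on `P⁵`: the points at which the differential
`T_x P⁵ → ℝ³` is not onto. -/
def criticalSet (a ε₀ ε₁ : ℝ) : Set Phase :=
  {x | x ∈ P5 a ∧ (tangent x).map (fderiv ℝ (momentum ε₀ ε₁) x).toLinearMap ≠ ⊤}

/-- The bifurcation diagram: the set of critical values of the momentum map on `P⁵`. -/
def bifurcationDiagram (a ε₀ ε₁ : ℝ) : Set (ℝ × ℝ × ℝ) :=
  momentum ε₀ ε₁ '' criticalSet a ε₀ ε₁

/-- `P(s) = [s - (h + ε₁² a²)]² - k`. -/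
def polyP (a ε₁ h k : ℝ) : ℝ[X] := (X - C (h + ε₁ ^ 2 * a ^ 2)) ^ 2 - C k

/-- `φ(s) = s³ - 2 h s² + [(h + ε₁² a²)² + a² ε₀² - 4 ε₁² ℓ² - k] s - 2 ε₀² ℓ²`. -/
def polyPhi (a ε₀ ε₁ h l k : ℝ) : ℝ[X] :=
  X ^ 3 - C (2 * h) * X ^ 2
    + C ((h + ε₁ ^ 2 * a ^ 2) ^ 2 + a ^ 2 * ε₀ ^ 2 - 4 * ε₁ ^ 2 * l ^ 2 - k) * X
    - C (2 * ε₀ ^ 2 * l ^ 2)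

/-- `S(s) = P(s) φ(s)`, the polynomial of the separated equations. -/
def polyS (a ε₀ ε₁ h l k : ℝ) : ℝ[X] := polyP a ε₁ h k * polyPhi a ε₀ ε₁ h l k

/-- The discriminant set: the real `(h, ℓ, k)` for which `S` has a multiple complex root. -/
def discriminantSet (a ε₀ ε₁ : ℝ) : Set (ℝ × ℝ × ℝ) :=
  {p | ∃ z : ℂ, 2 ≤ ((polyS a ε₀ ε₁ p.1 p.2.1 p.2.2).map (algebraMap ℝ ℂ)).rootMultiplicity z}

/-- Generating function of the first surface. -/
def Phi1 (p : ℝ × ℝ × ℝ) : ℝ := p.2.2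

/-- Generating function of the second surface. -/
def Phi2 (a ε₀ ε₁ : ℝ) (p : ℝ × ℝ × ℝ) : ℝ :=
  p.2.2 - 1 / (4 * ε₁ ^ 4) * (2 * ε₁ ^ 2 * (p.1 + ε₁ ^ 2 * a ^ 2) + ε₀ ^ 2) ^ 2

/-- Generating function of the third surface. -/
def Phi3 (a ε₁ : ℝ) (p : ℝ × ℝ × ℝ) : ℝ :=
  p.2.2 - (a ^ 2 * (p.1 + ε₁ ^ 2 * a ^ 2) - 2 * p.2.1 ^ 2) ^ 2 / a ^ 4

/-- The value of `k` on the fourth surface. -/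
def k4 (a ε₀ ε₁ h s : ℝ) : ℝ :=
  4 * ε₁ ^ 2 / ε₀ ^ 2 * s ^ 3 + (3 - 4 * ε₁ ^ 2 / ε₀ ^ 2 * h) * s ^ 2 - 4 * h * s
    + a ^ 2 * ε₀ ^ 2 + (h + ε₁ ^ 2 * a ^ 2) ^ 2

/-- `Π₁`. -/
def Pi1 : Set (ℝ × ℝ × ℝ) := {p | p.2.2 = 0}

/-- `Π₂`. -/
def Pi2 (a ε₀ ε₁ : ℝ) : Set (ℝ × ℝ × ℝ) :=
  {p | p.2.2 = 1 / (4 * ε₁ ^ 4) * (2 * ε₁ ^ 2 * (p.1 + ε₁ ^ 2 * a ^ 2) + ε₀ ^ 2) ^ 2}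

/-- `Π₃`. -/
def Pi3 (a ε₁ : ℝ) : Set (ℝ × ℝ × ℝ) :=
  {p | p.2.2 = (a ^ 2 * (p.1 + ε₁ ^ 2 * a ^ 2) - 2 * p.2.1 ^ 2) ^ 2 / a ^ 4}

/-- `Π₄`, with the real parameter `s`. -/
def Pi4 (a ε₀ ε₁ : ℝ) : Set (ℝ × ℝ × ℝ) :=
  {p | ∃ s : ℝ, p.2.1 ^ 2 = 1 / ε₀ ^ 2 * (p.1 - s) * s ^ 2 ∧ p.2.2 = k4 a ε₀ ε₁ p.1 s}

/-- The real solutions, over the surface `Φ = 0`, of the system `Φ = 0`, `dΦ = 0` on `P⁵`, where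
the functions `H, L, K` are substituted for `(h, ℓ, k)`: the critical subsystem generated by `Φ`. -/
def solutions (a ε₀ ε₁ : ℝ) (Φ : ℝ × ℝ × ℝ → ℝ) : Set Phase :=
  {x | x ∈ P5 a ∧ Φ (momentum ε₀ ε₁ x) = 0 ∧
    ∀ v ∈ tangent x, fderiv ℝ (fun y => Φ (momentum ε₀ ε₁ y)) x v = 0}

/-- The same for `Π₄`. Eliminating `ds` from the parametric equations, one gets the equation
`dk - 2 (h + ε₁² a² - s) dh + 4 (ε₀² + 2 ε₁² s) (ℓ / s) dℓ = 0` of the tangent plane of `Π₄`.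
The quotient `t = ℓ / s` is kept as an unknown (`ℓ = t s`, `h - s = ε₀² t²`), so that `s = 0` is
allowed. -/
def solutions4 (a ε₀ ε₁ : ℝ) : Set Phase :=
  {x | x ∈ P5 a ∧ ∃ s t : ℝ,
    L x = t * s ∧ H ε₀ ε₁ x - s = ε₀ ^ 2 * t ^ 2 ∧ K ε₀ ε₁ x = k4 a ε₀ ε₁ (H ε₀ ε₁ x) s ∧
    ∀ v ∈ tangent x,
      fderiv ℝ (K ε₀ ε₁) x v - 2 * (H ε₀ ε₁ x + ε₁ ^ 2 * a ^ 2 - s) * fderiv ℝ (H ε₀ ε₁) x v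
        + 4 * (ε₀ ^ 2 + 2 * ε₁ ^ 2 * s) * t * fderiv ℝ L x v = 0}

/-- The part of `Π₁` that corresponds to real solutions. -/
def realPart1 (a ε₀ ε₁ : ℝ) : Set (ℝ × ℝ × ℝ) :=
  {p ∈ Pi1 | ∃ x ∈ solutions a ε₀ ε₁ Phi1, momentum ε₀ ε₁ x = p}

/-- The part of `Π₂` that corresponds to real solutions. -/
def realPart2 (a ε₀ ε₁ : ℝ) : Set (ℝ × ℝ × ℝ) :=
  {p ∈ Pi2 a ε₀ ε₁ | ∃ x ∈ solutions a ε₀ ε₁ (Phi2 a ε₀ ε₁), momentum ε₀ ε₁ x = p}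

/-- The part of `Π₃` that corresponds to real solutions. -/
def realPart3 (a ε₀ ε₁ : ℝ) : Set (ℝ × ℝ × ℝ) :=
  {p ∈ Pi3 a ε₁ | ∃ x ∈ solutions a ε₀ ε₁ (Phi3 a ε₁), momentum ε₀ ε₁ x = p}

/-- The part of `Π₄` that corresponds to real solutions. -/
def realPart4 (a ε₀ ε₁ : ℝ) : Set (ℝ × ℝ × ℝ) :=
  {p ∈ Pi4 a ε₀ ε₁ | ∃ x ∈ solutions4 a ε₀ ε₁, momentum ε₀ ε₁ x = p}

end KowalevskiSokolov

end

noncomputable section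

namespace KowalevskiSokolov

set_option linter.unusedSectionVars false

/-! ### Algebraic elimination from the critical relation, in complex coordinates. -/

section Elimination

/-! Complex coordinates: `x, y = α₁ ± i α₂`, `z = α₃`, `w = M₃`, `κ = i ε₁`, `p = ε₀`,
`W₁, W₂ = (M₁ ± i M₂) / 2 ± κ z`; the critical relation is
`dK - 2 σ dH + 4 τ dL + c dΓ = 0`. -/

variable {F : Type*} [Field F] [CharZero F]

/-! The discriminant set rests on the identity `φ(s) - s P(s) = (2 ε₁² s + ε₀²)(a² s - 2 ℓ²)`. A
double root of `P` means `k = 0`; a common root of `P` and `φ` is `-ε₀² / (2 ε₁²)` or `2 ℓ² / a²`,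
which gives `Π₂` and `Π₃`; a double root of `φ` is real, because `φ` is a real cubic, and gives
`Π₄`.

A point of `P⁵` is critical exactly when some nontrivial combination of `dK, dH, dL` is a multiple
of `dΓ` (`exists_relation`, `mem_criticalSet`). Each system defining a real part is such a relation
with coefficient 1 at `dK`, so real parts consist of critical values. For the converse, normalize to
`dK - 2σ dH + 4τ dL + c dΓ = 0` and put `s = h + ε₁² a² - σ`, so that `P(s) = σ² - k`. If `k = 0`,
then `dK = 0` and the point belongs to `Π₁`. Otherwise the six components of the relation are solved
by `elimination`. If `k = σ²`, then `s` is a root of `P`, and the relation is that of `Π₂` or `Π₃`,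
up to one exceptional family. If `k ≠ σ²` and `τ ≠ 0`, `factorization` leaves two possibilities: one
yields the equations of `Π₄`, the other only two exceptional families; `τ = 0` is treated apart,
with the same outcome. At an exceptional point `σ, τ` are not determined, and they can be replaced
by the values belonging to `Π₃` (`mem_solutions3_of_collinear`, `mem_solutions3_of_planar`). If `dK`
does not occur in the relation, the point is critical for some `H - 2τL` on `P⁵`. Such points are
found explicitly in `exists_solution_of_dH_relation` and lie in the third or fourth subsystem. -/

theorem mul_eq_zero_of_Z_mul_Z_eq_sq {x y W₁ W₂ Z₁ Z₂ σ τ : F}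
    (h₁ : W₁ * Z₂ - σ * W₂ + τ * y = 0) (h₂ : W₂ * Z₁ - σ * W₁ + τ * x = 0)
    (hK : Z₁ * Z₂ = σ ^ 2) : τ * (σ * x + y * Z₁) = 0 := by
  -- `h₁, h₂` form a linear system for `W₁, W₂` with determinant `Z₁ Z₂ - σ²`; this is its
  -- compatibility condition when the determinant vanishes.
  linear_combination Z₁ * h₁ + σ * h₂ - W₁ * hK

/-- If `k = σ²` and `τ ≠ 0`, then `a² τ = 2 ℓ σ` and `a² s = 2 ℓ²`, for `α` off the vertical axis. -/
theorem area_relations_of_ne_zero {p κ x y z w v W₁ W₂ A B Z₁ Z₂ σ τ : F}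
    (hv : v = w + κ * (x - y)) (hA : A = p - κ * v + κ ^ 2 * x) (hB : B = p + κ * v + κ ^ 2 * y)
    (hZ₁ : Z₁ = W₁ ^ 2 + x * A) (hZ₂ : Z₂ = W₂ ^ 2 + y * B)
    (h₁ : W₁ * Z₂ - σ * W₂ + τ * y = 0)
    (h₄ : κ * (y * Z₁ - x * Z₂) - σ * (w + v) + 2 * τ * z = 0)
    (hx : x ≠ 0) (hy : y ≠ 0) (hσ : σ ≠ 0)
    (e₁ : σ * x + y * Z₁ = 0) (e₂ : σ * y + x * Z₂ = 0) :
    (x * y + z ^ 2) * τ = σ * (W₁ * y + W₂ * x + z * v) ∧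
    (x * y + z ^ 2) * (2 * W₁ * W₂ + w ^ 2 - (x * A + y * B) - 2 * σ) =
      (W₁ * y + W₂ * x + z * v) ^ 2 := by
  have i₁ : τ * (x * y) = σ * (W₁ * y + W₂ * x) := by linear_combination x * h₁ - W₁ * e₂
  have i₂ : τ * z = σ * v := by
    linear_combination (1/2) * h₄ - κ / 2 * e₁ + κ/2 * e₂ - σ /2 * hv
  have i₃ : (x * y + z ^ 2) * τ = σ * (W₁ * y + W₂ * x + z * v) := by
    linear_combination i₁ + z * i₂
  refine ⟨i₃, ?_⟩
  have i₄ : x * y * (2 * W₁ * W₂ + w ^ 2 - (x * A + y * B) - 2 * σ) =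
     (W₁ * y + W₂ * x) ^ 2  + x * y * v ^ 2 := by
    clear h₁ h₄ i₁ i₂ i₃
    grind
  -- By `i₁, i₂` the pair `σ (W₁ y + W₂ x, v)` equals `τ (x y, z)`, so both sides are `τ² (x y)(x y
  -- + z²)²`.
  have : σ ^ 2 * (x * y) * ((x * y + z ^ 2) * (2 * W₁ * W₂ + w ^ 2 - (x * A + y * B) - 2 * σ)) =
      σ ^ 2 * (x * y) * (W₁ * y + W₂ * x + z * v) ^ 2 := by
    linear_combination (x * y + z ^ 2) * σ ^ 2 * i₄
      - (x * y + z ^ 2) * (τ * (x * y) + σ * (W₁ * y + W₂ * x)) * i₁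
      - (x * y + z ^ 2) * (x * y) * (τ * z + σ * v) * i₂
      + (x * y) * ((x * y + z ^ 2) * τ + σ * (W₁ * y + W₂ * x + z * v)) * i₃
  exact mul_left_cancel₀ (by simp [hx, hy, hσ]) this

/-- For vertical `α` one has `Zᵢ = Wᵢ²`, so `h₁` forces `σ = W₁ W₂`, and `h₄` becomes `τ z = σ w`.
-/
theorem area_relations_of_eq_zero {κ x y z w v W₁ W₂ A B Z₁ Z₂ σ τ : F}
    (hv : v = w + κ * (x - y))
    (hZ₁ : Z₁ = W₁ ^ 2 + x * A) (hZ₂ : Z₂ = W₂ ^ 2 + y * B)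
    (h₁ : W₁ * Z₂ - σ * W₂ + τ * y = 0)
    (h₄ : κ * (y * Z₁ - x * Z₂) - σ * (w + v) + 2 * τ * z = 0)
    (hx : x = 0) (hy : y = 0) (hσ : σ ≠ 0)
    (hK : Z₁ * Z₂ = σ ^ 2) :
    (x * y + z ^ 2) * τ = σ * (W₁ * y + W₂ * x + z * v) ∧
    (x * y + z ^ 2) * (2 * W₁ * W₂ + w ^ 2 - (x * A + y * B) - 2 * σ) =
      (W₁ * y + W₂ * x + z * v) ^ 2 := by
  subst hx hy
  have hv : v = w := by simpa using hv
  subst hv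
  simp only [mul_zero, zero_mul, add_zero, sub_zero, zero_add] at *
  subst hZ₁ hZ₂
  have : W₂ ≠ 0 := by
    rintro rfl
    apply hσ
    simpa using hK.symm
  have e : σ = W₁ * W₂ := mul_right_cancel₀ this (by linear_combination -h₁)
  constructor
  · linear_combination z / 2 * h₄
  · linear_combination -2 * z ^ 2 * e

/-- If `k = σ²`, `τ = 0` and the multiplier of the Casimir function vanishes, then
`ε₀² + 2 ε₁² s = 0`, unless `Z₁ = -σ`. -/
theorem resonance_of_add_ne_zero {p κ x y w v W₁ W₂ A B Z₁ Z₂ σ : F}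
    (hv : v = w + κ * (x - y)) (hA : A = p - κ * v + κ ^ 2 * x) (hB : B = p + κ * v + κ ^ 2 * y)
    (hZ₁ : Z₁ = W₁ ^ 2 + x * A)
    (h₁ : W₁ * Z₂ - σ * W₂ = 0)
    (h₅ : A * Z₂ + κ ^ 2 * y * Z₁ + σ * (A + κ ^ 2 * y) = 0)
    (h₆ : B * Z₁ + κ ^ 2 * x * Z₂ + σ * (B + κ ^ 2 * x) = 0)
    (hσ : σ ≠ 0) (hK : Z₁ * Z₂ = σ ^ 2) (hu : Z₁ + σ ≠ 0) :
    p ^ 2 - κ ^ 2 * (2 * W₁ * W₂ + w ^ 2 - (x * A + y * B) - 2 * σ) = 0 := by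
  have hu' : Z₂ + σ ≠ 0 := by
    intro h
    have : σ * (Z₁ + σ) = 0 := by linear_combination -hK + Z₁ * h
    simp_all
  -- Since `Z₁ Z₂ = σ²`, the product of `Z₁` and `h₅` is `(Z₁ + σ)(A σ + κ² y Z₁)`.
  have e₁ : A * σ + κ ^ 2 * y * Z₁ = 0 := by
    apply mul_left_cancel₀ hu
    linear_combination Z₁ * h₅ - A * hK
  have e₂ : B * σ + κ ^ 2 * x * Z₂ = 0 := by
    apply mul_left_cancel₀ hu'
    linear_combination Z₂ * h₆ - B * hK
  have e₃ : A * Z₂ + κ ^ 2 * y * σ = 0 := by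
    apply mul_left_cancel₀ hσ
    linear_combination Z₂ * e₁ - κ ^ 2 * y * hK
  have e₄ : σ = W₁ * W₂ - κ ^ 2 * (x * y) := by
    apply mul_left_cancel₀ hσ
    linear_combination -hK + Z₂ * hZ₁ + W₁ * h₁ + x * e₃
  have e₅ : A * B = κ ^ 4 * (x * y) := by
    apply mul_left_cancel₀ (pow_ne_zero 2 hσ)
    linear_combination B * σ * e₁ - κ ^ 2 * y * Z₁ * e₂ + κ ^ 4 * x * y * hK
  subst hv hA hB
  linear_combination e₅ + 2 * κ ^ 2 * e₄

/-- The case excluded from `resonance_of_add_ne_zero`: `Z₁ = Z₂ = -σ` forces `W₂ = -W₁`, `w = 0`, `x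
= y`. Then `ℓ = s = 0`, so the point falls under `Π₃` with `τ = 0`. -/
theorem area_eq_zero_of_Z_eq_neg {p κ x y w v W₁ W₂ A B Z₁ Z₂ σ z : F}
    (hv : v = w + κ * (x - y)) (hA : A = p - κ * v + κ ^ 2 * x) (hB : B = p + κ * v + κ ^ 2 * y)
    (hZ₁ : Z₁ = W₁ ^ 2 + x * A) (hZ₂ : Z₂ = W₂ ^ 2 + y * B)
    (h₁ : W₁ * Z₂ - σ * W₂ = 0)
    (h₄ : κ * (y * Z₁ - x * Z₂) - σ * (w + v) = 0)
    (hp : p ≠ 0) (hσ : σ ≠ 0) (hK : Z₁ * Z₂ = σ ^ 2) (hu : Z₁ + σ = 0) :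
    W₁ * y + W₂ * x + z * v = 0 ∧ 2 * W₁ * W₂ + w ^ 2 - (x * A + y * B) - 2 * σ = 0 := by
  have hu' : Z₂ + σ = 0 := by
    apply mul_left_cancel₀ hσ
    linear_combination Z₂ * hu - hK
  have e₁ : W₂ = - W₁ := by
    apply mul_left_cancel₀ hσ
    linear_combination -h₁ + W₁ * hu'
  have e₂ : w = 0 := by
    apply mul_left_cancel₀ hσ
    linear_combination -h₄ /2 - σ /2 * hv + κ / 2 * y * hu - κ /2 * x * hu'
  subst hv hA hB e₁ e₂
  have e₃ : x = y := by
    apply mul_left_cancel₀ hp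
    linear_combination hu - hu' + hZ₂ - hZ₁
  subst e₃
  constructor
  · ring
  · linear_combination -hu - hu' + hZ₁ + hZ₂

/-- The equations yield `Z₁ = Z₂` or `σ = W₁ W₂ - κ² x y`. The second alternative makes `c y = 0`,
as does `Z₁ = -σ` in the first, so `Z₁ = Z₂ = σ` remains. Together with `z = 0` the conclusion says
that `α` and `M` both lie on the first axis. -/
theorem collinear_of_Z_mul_Z_eq_sq {p κ x y w v W₁ W₂ A B Z₁ Z₂ σ c : F}
    (hv : v = w + κ * (x - y)) (hA : A = p - κ * v + κ ^ 2 * x) (hB : B = p + κ * v + κ ^ 2 * y)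
    (hZ₁ : Z₁ = W₁ ^ 2 + x * A) (hZ₂ : Z₂ = W₂ ^ 2 + y * B)
    (h₁ : W₁ * Z₂ - σ * W₂ = 0) (h₂ : W₂ * Z₁ - σ * W₁ = 0)
    (h₄ : κ * (y * Z₁ - x * Z₂) - σ * (w + v) = 0)
    (h₅ : A * Z₂ + κ ^ 2 * y * Z₁ + σ * (A + κ ^ 2 * y) + c * y = 0)
    (h₆ : B * Z₁ + κ ^ 2 * x * Z₂ + σ * (B + κ ^ 2 * x) + c * x = 0)
    (hx : x ≠ 0) (hy : y ≠ 0) (hσ : σ ≠ 0) (hc : c ≠ 0) (hK : Z₁ * Z₂ = σ ^ 2) :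
    x = y ∧ w = 0 ∧ W₁ = W₂ := by
  have e' : (Z₁ - Z₂) * (σ - W₁ * W₂ + κ ^ 2 * (x * y)) = 0 := by
    apply mul_left_cancel₀ hσ
    have e₁ : x * A * Z₂ = σ * (σ - W₁ * W₂) := by
      linear_combination -Z₂ * hZ₁ + hK - W₁ * h₁
    have e₂ : y * B * Z₁ = σ * (σ - W₁ * W₂) := by
      linear_combination -Z₁ * hZ₂ + hK - W₂ * h₂
    have e₃ : σ * (x * A - y * B) = - κ ^ 2 * (x * y) * (Z₁ - Z₂) := by
      linear_combination x * h₅ - y * h₆ - e₁ + e₂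
    apply mul_left_cancel₀ hσ
    linear_combination Z₁ * Z₂ * e₃ - σ * Z₁ * e₁ + σ * Z₂ * e₂ - κ ^ 2 * (x * y) * (Z₁ - Z₂) * hK
  have hcy := mul_ne_zero hc hy
  rcases mul_eq_zero.1 e' with e | e
  · have e₀ : (Z₁ - σ) * (Z₁ + σ) = 0 := by linear_combination hK + Z₁ * e
    rcases mul_eq_zero.1 e₀ with e₀ | e₀
    · have e₁ : W₁ = W₂ := by
        apply mul_left_cancel₀ hσ
        linear_combination h₁ + W₁ * e - W₁ * e₀
      have e₂ : v = 0 := by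
        apply mul_left_cancel₀ hσ
        linear_combination -h₄ / 2 + σ / 2 * hv + κ * x/2 * e + κ * (y - x) / 2 * e₀
      subst e₂ e₁
      have e₃ : (x - y) * (p + κ ^ 2 * (x + y)) = 0 := by
        subst hA hB
        linear_combination e - hZ₁ + hZ₂
      rcases mul_eq_zero.1 e₃ with e₃ | e₃
      · have : x = y := sub_eq_zero.1 e₃
        subst this
        refine ⟨rfl, ?_, rfl⟩
        simpa using hv.symm
      · exfalso
        apply hcy
        linear_combination h₅ - (Z₂ + σ) * e₃ - (Z₂ + σ) * hA - κ ^ 2 * y * e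
    · exfalso
      apply hcy
      linear_combination h₅ - (A + κ ^ 2 * y) * e₀ + A * e
  · exfalso
    apply hcy
    have e₁ : A * Z₂ = - κ ^ 2 * y * σ := by
      apply mul_left_cancel₀ hx
      linear_combination -Z₂ * hZ₁ + hK - W₁ * h₁ + σ * e
    have e₂ : A * σ = - κ ^ 2 * y * Z₁ := by
      apply mul_left_cancel₀ hσ
      linear_combination Z₁ * e₁ - A * hK
    linear_combination h₅ - e₁ - e₂

/-- Cramer's rule for `h₁, h₂`; used to get `W₁ = 0` when `τ = 0` and `k ≠ σ²`. -/
theorem W_mul_sub_eq {x y W₁ W₂ Z₁ Z₂ σ τ : F}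
    (h₁ : W₁ * Z₂ - σ * W₂ + τ * y = 0) (h₂ : W₂ * Z₁ - σ * W₁ + τ * x = 0) :
    W₁ * (Z₁ * Z₂ - σ ^ 2) = - τ * (σ * x + y * Z₁) := by
  linear_combination Z₁ * h₁ + σ * h₂

/-- Here `h₄` reads `(σ + κ² x y)(w + v) = 0`. The first factor leads to the fourth subsystem with
`t = 0`, the second to the two exceptional families. -/
theorem cases_of_W_eq_zero {p κ x y z w v A B σ c : F}
    (hv : v = w + κ * (x - y)) (hA : A = p - κ * v + κ ^ 2 * x) (hB : B = p + κ * v + κ ^ 2 * y)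
    (h₃ : c * z = 0)
    (h₄ : κ * (y * (x * A) - x * (y * B)) - σ * (w + v) = 0)
    (h₅ : A * (y * B) + κ ^ 2 * y * (x * A) + σ * (A + κ ^ 2 * y) + c * y = 0)
    (h₆ : B * (x * A) + κ ^ 2 * x * (y * B) + σ * (B + κ ^ 2 * x) + c * x = 0)
    (hK₀ : x * A * (y * B) ≠ 0) (hK : x * A * (y * B) ≠ σ ^ 2) :
    (z = 0 ∧ σ = - κ ^ 2 * (x * y) ∧ x * A * (y * B) = σ ^ 2 + x * y *
        (p ^ 2 - κ ^ 2 * (w ^ 2 - (x * A + y * B) - 2 * σ))) ∨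
      (x = y ∧ z = 0 ∧ w = 0) ∨ (p = - κ ^ 2 * (x + y) ∧ w = 0 ∧ z ≠ 0 ∧ x = y) := by
  have hxA := left_ne_zero_of_mul hK₀
  have hyB := right_ne_zero_of_mul hK₀
  have hx := left_ne_zero_of_mul hxA
  have hA₀ := right_ne_zero_of_mul hxA
  have hy := left_ne_zero_of_mul hyB
  have hB₀ := right_ne_zero_of_mul hyB
  have e₁ : (σ + κ ^ 2 * (x * y)) * (w + v) = 0 := by
    linear_combination -h₄ + κ * x * y * hA - κ * x * y * hB - κ ^ 2 * x * y * hv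
  by_cases hσ : σ + κ ^ 2 * (x * y) = 0
  · rcases mul_eq_zero.1 h₃ with hc | hz
    · exfalso
      apply hK
      have : A * B = κ ^ 4 * (x * y) := by
        apply mul_left_cancel₀ hy
        linear_combination h₅ - (A + κ ^ 2 * y) * hσ - y * hc
      linear_combination x * y * this - (σ - κ ^ 2 * (x * y)) * hσ
    · left
      refine ⟨hz, by linear_combination hσ, ?_⟩
      subst hA hB hv
      linear_combination (-σ - κ ^ 2 * (x * y)) * hσ
  · have e₂ : w + v = 0 := by simpa [hσ] using e₁
    have e₃ : A = B := by linear_combination hA - hB - κ * e₂ - κ * hv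
    subst e₃
    have e₄ : x = y := by
      have : A * (σ + κ ^ 2 * (x * y)) * (x - y) = 0 := by
        linear_combination x * h₅ - y * h₆
      simpa [hA₀, hσ, sub_eq_zero] using this
    subst e₄
    have hw : w = 0 := by linear_combination (e₂ - hv) / 2
    right
    by_cases hz : z = 0
    · exact Or.inl ⟨rfl, hz, hw⟩
    · right
      refine ⟨?_, hw, hz, rfl⟩
      have hc : c = 0 := by simpa [hz] using h₃
      have e₅ : (A + κ ^ 2 * x) * (x * A + σ) = 0 := by
        linear_combination h₅ - x * hc
      rcases mul_eq_zero.1 e₅ with e | e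
      · linear_combination e - hA + κ * hv + κ * hw
      · exfalso
        apply hK
        linear_combination (x * A - σ) * e

/-- The Poisson bracket of the critical relation with `Z₁`. -/
theorem bracket_identity {p κ x y z w v W₁ W₂ A B Z₁ Z₂ σ τ c : F}
    (hv : v = w + κ * (x - y)) (hA : A = p - κ * v + κ ^ 2 * x) (hB : B = p + κ * v + κ ^ 2 * y)
    (hZ₁ : Z₁ = W₁ ^ 2 + x * A) (hZ₂ : Z₂ = W₂ ^ 2 + y * B)
    (h₁ : W₁ * Z₂ - σ * W₂ + τ * y = 0) (h₂ : W₂ * Z₁ - σ * W₁ + τ * x = 0)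
    (h₃ : τ * v + c * z = 0)
    (h₄ : κ * (y * Z₁ - x * Z₂) - σ * (w + v) + 2 * τ * z = 0)
    (h₅ : A * Z₂ + κ ^ 2 * y * Z₁ + σ * (A + κ ^ 2 * y) + 2 * τ * (W₂ + κ * z) + c * y = 0)
    (h₆ : B * Z₁ + κ ^ 2 * x * Z₂ + σ * (B + κ ^ 2 * x) + 2 * τ * (W₁ - κ * z) + c * x = 0)
    (hK₀ : Z₁ ≠ 0) :
    v * W₁ * W₂ + z * (B * W₁ + A * W₂) + κ ^ 2 * z * (y * W₁ + x * W₂)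
      - κ * (y * W₁ ^ 2 - x * W₂ ^ 2) + κ ^ 2 * (x * y) * w + σ * w = 0 := by
  apply mul_left_cancel₀ hK₀
  subst hZ₁ hZ₂ hA hB hv
  linear_combination (- κ * x * W₁) * h₁
    + ((w + κ * (x - y)) * W₁ + z * (p - κ * (w + κ * (x - y)) + κ ^ 2 * x) + κ * x * W₂ + κ ^ 2 * x * z) * h₂
    - x * W₁ * h₃ + (-2 * W₁ ^ 2 + 2 * κ * z * W₁ - x * (p - κ * (w + κ * (x - y)) + κ ^ 2 * x)
      + κ ^ 2 * (x * y)) * h₄ / 2 - κ * x ^ 2 / 2 * h₅ + (2 * z * W₁ + κ * (x * y)) / 2 * h₆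

/-- Subtracting `h₄` from the bracket identity expresses `v N`, with `N = σ - W₁ W₂ + κ² x y`, as a
multiple of `z`. After multiplication by `x y`, the equations `h₁, h₂` make `N` a factor of the
other side as well. -/
theorem factorization {p κ x y z w v W₁ W₂ A B Z₁ Z₂ σ τ c : F}
    (hv : v = w + κ * (x - y)) (hA : A = p - κ * v + κ ^ 2 * x) (hB : B = p + κ * v + κ ^ 2 * y)
    (hZ₁ : Z₁ = W₁ ^ 2 + x * A) (hZ₂ : Z₂ = W₂ ^ 2 + y * B)
    (h₁ : W₁ * Z₂ - σ * W₂ + τ * y = 0) (h₂ : W₂ * Z₁ - σ * W₁ + τ * x = 0)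
    (h₃ : τ * v + c * z = 0)
    (h₄ : κ * (y * Z₁ - x * Z₂) - σ * (w + v) + 2 * τ * z = 0)
    (h₅ : A * Z₂ + κ ^ 2 * y * Z₁ + σ * (A + κ ^ 2 * y) + 2 * τ * (W₂ + κ * z) + c * y = 0)
    (h₆ : B * Z₁ + κ ^ 2 * x * Z₂ + σ * (B + κ ^ 2 * x) + 2 * τ * (W₁ - κ * z) + c * x = 0)
    (hK₀ : Z₁ ≠ 0) :
    (σ - W₁ * W₂ + κ ^ 2 * (x * y)) * (v * (x * y) - z * (y * W₁ + x * W₂)) = 0 := by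
  have e := bracket_identity hv hA hB hZ₁ hZ₂ h₁ h₂ h₃ h₄ h₅ h₆ hK₀
  have e₁ : v * (σ - W₁ * W₂ + κ ^ 2 * (x * y)) =
      z * (B * W₁ + A * W₂ + 2 * τ + κ ^ 2 * (y * W₁ + x * W₂)) := by
    subst hZ₁ hZ₂ hA hB hv
    linear_combination -e - h₄
  linear_combination x * y * e₁ + z * x * h₁ + z * y * h₂ - z * x * W₁ * hZ₂ - z * y * W₂ * hZ₁

/-- The relations on the fourth critical subsystem, on which `φ` has the double root `s`. -/
theorem double_root_relations {p κ x y z w v W₁ W₂ A B Z₁ Z₂ σ τ t : F}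
    (hv : v = w + κ * (x - y)) (hA : A = p - κ * v + κ ^ 2 * x) (hB : B = p + κ * v + κ ^ 2 * y)
    (hZ₁ : Z₁ = W₁ ^ 2 + x * A) (hZ₂ : Z₂ = W₂ ^ 2 + y * B)
    (h₁ : W₁ * Z₂ - σ * W₂ + τ * y = 0) (h₂ : W₂ * Z₁ - σ * W₁ + τ * x = 0)
    (h₄ : κ * (y * Z₁ - x * Z₂) - σ * (w + v) + 2 * τ * z = 0)
    (hx : x ≠ 0) (hy : y ≠ 0) (hτ : τ ≠ 0) (hp : p ≠ 0)
    (hN : σ - W₁ * W₂ + κ ^ 2 * (x * y) = 0) (ht : -2 * p * t = W₁ + W₂) :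
    let s₂ := 2 * W₁ * W₂ + w ^ 2 - (x * A + y * B) - 2 * σ
    τ = (p ^ 2 - κ ^ 2 * s₂) * t ∧ W₁ * y + W₂ * x + z * v = t * s₂ ∧
      σ = p ^ 2 * t ^ 2 - κ ^ 2 * (x * y + z ^ 2) ∧
      Z₁ * Z₂ = σ ^ 2 + (p ^ 2 - κ ^ 2 * s₂) * (x * y + z ^ 2 - t ^ 2 * s₂) := by
  intro s₂
  -- With `N = 0`, `h₁` and `h₂` can be divided by `y` and `x`. The difference of the results gives
  -- `W₁ - W₂`, and `ht` gives `W₁ + W₂`, so both are expressed through `t` and `v`.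
  have a₁ : W₁ * B + τ = - κ ^ 2 * x * W₂ := by
    apply mul_left_cancel₀ hy
    linear_combination h₁ - W₁ * hZ₂ + W₂ * hN
  have a₂ : W₂ * A + τ = - κ ^ 2 * y * W₁ := by
    apply mul_left_cancel₀ hx
    linear_combination h₂ - W₂ * hZ₁ + W₁ * hN
  have d : W₁ - W₂ = 2 * κ * v * t := by
    apply mul_left_cancel₀ hp
    subst hA hB hv
    linear_combination a₁ - a₂ + κ * (w + κ * (x - y)) * ht
  have e₁ : W₁ = - t * (p - κ * v) := by linear_combination d / 2 - ht / 2
  have e₂ : W₂ = - t * (p + κ * v) := by linear_combination -d / 2 - ht / 2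
  have hs : s₂ = w * v - p * (x + y) := by
    simp only [s₂]
    subst hA hB
    linear_combination (-2) * hN - w * hv + κ * (x - y) * hv
  have hτ' : τ = (p ^ 2 - κ ^ 2 * s₂) * t := by
    rw [hs]
    subst hA hB hv e₁ e₂
    linear_combination a₁
  have hz : z = t * v := by
    apply mul_left_cancel₀ hτ
    rw [hs] at hτ'
    subst hA hB hZ₁ hZ₂ e₁ e₂ hv
    linear_combination h₄ / 2 - t * (w + κ * (x - y)) * hτ' + (2 * w + κ * (x - y)) / 2 * hN
  have hσ : σ = p ^ 2 * t ^ 2 - κ ^ 2 * (x * y + z ^ 2) := by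
    rw [hz]
    subst e₁ e₂
    linear_combination hN
  refine ⟨hτ', ?_, hσ, ?_⟩
  · rw [hs, hz, e₁, e₂]
    linear_combination t * v * hv
  · rw [hs, hσ, hz]
    subst hA hB hZ₁ hZ₂ e₁ e₂ hv
    ring

/-- Critical points with `z = 0` and `k ≠ σ²`, `τ ≠ 0`, off the fourth critical subsystem. -/
theorem collinear_of_z_eq_zero {p κ x y w v A B Z₁ Z₂ σ τ c a b : F}
    (hv : v = w + κ * (x - y)) (hA : A = p - κ * v + κ ^ 2 * x) (hB : B = p + κ * v + κ ^ 2 * y)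
    (hZ₁ : Z₁ = (x * a) ^ 2 + x * A) (hZ₂ : Z₂ = (y * b) ^ 2 + y * B)
    (g₁ : (σ - x * y * a * b) * b = a * (x * B) + τ)
    (g₂ : (σ - x * y * a * b) * a = b * (y * A) + τ)
    (h₄ : κ * (y * Z₁ - x * Z₂) - σ * (w + v) = 0)
    (h₅ : A * Z₂ + κ ^ 2 * y * Z₁ + σ * (A + κ ^ 2 * y) + 2 * τ * (y * b) + c * y = 0)
    (h₆ : B * Z₁ + κ ^ 2 * x * Z₂ + σ * (B + κ ^ 2 * x) + 2 * τ * (x * a) + c * x = 0)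
    (hv₀ : v = 0) (hx : x ≠ 0) (hy : y ≠ 0) (ha : a ≠ 0) (hκ : κ ≠ 0) (hp : p ≠ 0)
    (hN : σ - x * y * a * b + κ ^ 2 * (x * y) ≠ 0) (hT : τ ≠ σ * (a + b)) :
    x = y ∧ w = 0 ∧ a = b := by
  have hw : w = - κ * (x - y) := by linear_combination hv₀ - hv
  have d₁ : (σ - x * y * a * b + κ ^ 2 * (x * y)) * (b - a) = p * (x * a - y * b) := by
    subst hA hB hv₀
    linear_combination g₁ - g₂
  have d₂ : x * y * (a + b) * (x * a - y * b) +
      (σ - x * y * a * b + κ ^ 2 * (x * y)) * (x - y) = 0 := by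
    apply mul_left_cancel₀ hκ
    subst hA hB hv₀ hw hZ₁ hZ₂
    linear_combination h₄
  -- The factor `N` is eliminated between `d₁` and `d₂`.
  have d₃ : (x * a - y * b) * (x * y * (a ^ 2 - b ^ 2) - p * (x - y)) = 0 := by
    linear_combination (a - b) * d₂ + (x - y) * d₁
  have hab : a = b → x = y ∧ w = 0 ∧ a = b := by
    rintro rfl
    have : p * a * (x - y) = 0 := by linear_combination -d₁
    have : x = y := by simpa [hp, ha, sub_eq_zero] using this
    exact ⟨this, by rw [hw, this]; ring, rfl⟩
  rcases mul_eq_zero.1 d₃ with e | e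
  · apply hab
    have : (σ - x * y * a * b + κ ^ 2 * (x * y)) * (b - a) = 0 := by
      rw [d₁, e, mul_zero]
    exact (sub_eq_zero.1 (by simpa [hN] using this)).symm
  · have d₄ : (x - y) * p * σ = τ * (x * y) * (a - b) := by
      subst hA hB hv₀ hw hZ₁ hZ₂
      linear_combination (x * h₅ - y * h₆ - (κ ^ 2 * (x + y) - p) * d₂) / 2 + κ ^ 2 * (x * y) * e
    have d₅ : x * y * (a - b) * (σ * (a + b) - τ) = 0 := by
      linear_combination d₄ + σ * e
    have hT' : σ * (a + b) - τ ≠ 0 := fun h => hT (by linear_combination -h)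
    apply hab
    simpa [hx, hy, hT', sub_eq_zero] using d₅

/-- In `x h₅ + y h₆`, multiplied by `a b`, every term contains `σ (a + b) - τ` by `t₁, t₂`.
Cancelling this nonzero quantity leaves an expression that factors. -/
theorem common_factor {p κ x y z v A B Z₁ Z₂ σ τ c a b : F}
    (hA : A = p - κ * v + κ ^ 2 * x) (hB : B = p + κ * v + κ ^ 2 * y)
    (hZ₁ : Z₁ = (x * a) ^ 2 + x * A) (hZ₂ : Z₂ = (y * b) ^ 2 + y * B)
    (g₁ : (σ - x * y * a * b) * b = a * (x * B) + τ)
    (g₂ : (σ - x * y * a * b) * a = b * (y * A) + τ)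
    (h₅ : A * Z₂ + κ ^ 2 * y * Z₁ + σ * (A + κ ^ 2 * y) + 2 * τ * (y * b + κ * z) + c * y = 0)
    (h₆ : B * Z₁ + κ ^ 2 * x * Z₂ + σ * (B + κ ^ 2 * x) + 2 * τ * (x * a - κ * z) + c * x = 0)
    (hv' : v = z * (a + b)) (hc : c = - τ * (a + b)) (hT : τ - σ * (a + b) ≠ 0) :
    (x * a + y * b) * (p + κ ^ 2 * (x + y) + κ * z * (a - b)) = 0 := by
  have t₁ : a * (σ + x * y * b ^ 2 + x * B) = σ * (a + b) - τ := by linear_combination -g₁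
  have t₂ : b * (σ + x * y * a ^ 2 + y * A) = σ * (a + b) - τ := by linear_combination -g₂
  have s : A * y * (σ + x * y * b ^ 2 + x * B) + B * x * (σ + x * y * a ^ 2 + y * A)
      + κ ^ 2 * (x ^ 2 * (σ + x * y * a ^ 2 + y * A) + y ^ 2 * (σ + x * y * b ^ 2 + x * B))
      + 2 * κ * z * (x - y) * (τ - σ * (a + b)) = 0 := by
    subst hZ₁ hZ₂ hc
    have : A - B - κ ^ 2 * (x - y) = -2 * κ * (z * (a + b)) := by
      linear_combination hA - hB - 2 * κ * hv'
    linear_combination x * h₅ + y * h₆ - σ * (x - y) * this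
  have f : (σ * (a + b) - τ) * (b * A * y + a * B * x + κ ^ 2 * (x ^ 2 * a + y ^ 2 * b)
      - 2 * κ * z * (x - y) * a * b) = 0 := by
    linear_combination a * b * s - b * (A * y + κ ^ 2 * y ^ 2) * t₁
      - a * (B * x + κ ^ 2 * x ^ 2) * t₂
  have f' := (mul_eq_zero.1 f).resolve_left (fun h => hT (by linear_combination -h))
  subst hA hB
  linear_combination f' - κ * (x * a - y * b) * hv'

/-- The factor `x a + y b` of `common_factor` does not vanish. -/
theorem false_of_antisymmetric {p κ x y z w v A B Z₁ Z₂ σ τ c a b : F}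
    (hv : v = w + κ * (x - y)) (hA : A = p - κ * v + κ ^ 2 * x) (hB : B = p + κ * v + κ ^ 2 * y)
    (hZ₁ : Z₁ = (x * a) ^ 2 + x * A) (hZ₂ : Z₂ = (y * b) ^ 2 + y * B)
    (g₁ : (σ - x * y * a * b) * b = a * (x * B) + τ)
    (g₂ : (σ - x * y * a * b) * a = b * (y * A) + τ)
    (h₄ : κ * (y * Z₁ - x * Z₂) - σ * (w + v) + 2 * τ * z = 0)
    (h₅ : A * Z₂ + κ ^ 2 * y * Z₁ + σ * (A + κ ^ 2 * y) + 2 * τ * (y * b + κ * z) + c * y = 0)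
    (h₆ : B * Z₁ + κ ^ 2 * x * Z₂ + σ * (B + κ ^ 2 * x) + 2 * τ * (x * a - κ * z) + c * x = 0)
    (hv' : v = z * (a + b)) (hx : x ≠ 0) (hy : y ≠ 0)
    (ha : a ≠ 0) (hp : p ≠ 0)
    (hN : σ - x * y * a * b + κ ^ 2 * (x * y) ≠ 0)
    (hT : τ - σ * (a + b) ≠ 0) (h : x * a + y * b = 0) : False := by
  obtain ⟨u, hu⟩ : ∃ u, u = x * a := ⟨_, rfl⟩
  obtain ⟨n, hn⟩ : ∃ n, n = σ - x * y * a * b + κ ^ 2 * (x * y) := ⟨_, rfl⟩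
  rw [← hn] at hN
  have hu' : y * b = - u := by linear_combination h + hu
  have hu₀ : u ≠ 0 := by simp [hu, hx, ha]
  have hxy : x * y ≠ 0 := mul_ne_zero hx hy
  have ea : x * y * a = y * u := by linear_combination -y * hu
  have eb : x * y * b = - x * u := by linear_combination x * hu'
  have eab : x * y * a * b = - u ^ 2 := by linear_combination -(y * b) * hu + u * hu'
  have hσ : σ = n - κ ^ 2 * (x * y) - u ^ 2 := by linear_combination -hn + eab
  have d₁ : n * (x + y) = - 2 * p * (x * y) := by
    apply mul_left_cancel₀ hu₀
    subst hA hB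
    linear_combination n * eb - n * ea - x * y * (b - a) * hn - x * y * g₁ + x * y * g₂
      + x * y * p * hu + x * y * p * hu' - x * y * κ * v * h
  -- `Q` divides both `2T` and `2zT`, where `T = τ - σ (a + b)`, so `Q ≠ 0`. The contradiction will
  -- be `Q (x + y) = 0` with `x + y ≠ 0`.
  obtain ⟨Q, hQ⟩ : ∃ Q, Q = 2 * u ^ 2 - n - 2 * κ * z * u := ⟨_, rfl⟩
  have t₁ : 2 * (τ - σ * (a + b)) = (a + b) * Q := by
    linear_combination -g₁ - g₂ + B * hu - A * hu' - (a + b) * eab - (a + b) * hQ - (a + b) * hσ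
      + u * hA - u * hB - 2 * κ * u * hv' + κ ^ 2 * ea + κ ^ 2 * eb
  have t₂ : 2 * z * (τ - σ * (a + b)) = κ * (x - y) * Q := by
    rw [← hu] at hZ₁
    rw [hu'] at hZ₂
    subst hZ₁ hZ₂
    linear_combination h₄ - κ * x * y * hA + κ * x * y * hB - σ * hv + 2 * σ * hv'
      + 2 * κ ^ 2 * x * y * hv' + 2 * κ ^ 2 * z * ea + 2 * κ ^ 2 * z * eb
      - κ * (x - y) * hσ - κ * (x - y) * hQ
  have hQ₀ : Q ≠ 0 := by
    rintro rfl
    apply hT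
    linear_combination t₁ / 2
  have hz : z * (a + b) = κ * (x - y) := by
    apply mul_right_cancel₀ hQ₀
    linear_combination t₂ - z * t₁
  have hxy' : x - y ≠ 0 := by
    intro h'
    have : a + b = 0 := by
      apply mul_left_cancel₀ hxy
      linear_combination ea + eb - u * h'
    apply hT
    linear_combination t₁ / 2 + Q / 2 * this
  have hzu : z * u = - κ * (x * y) := by
    apply mul_right_cancel₀ hxy'
    linear_combination -x * y * hz + z * ea + z * eb
  have hτ : 2 * τ = (a + b) * n := by
    linear_combination t₁ + 2 * (a + b) * hσ + (a + b) * hQ - 2 * κ * (a + b) * hzu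
  have hw : w = 0 := by linear_combination -hv + hv' + hz
  subst hw
  have hA' : A = p + κ ^ 2 * y := by linear_combination hA - κ * hv
  have hB' : B = p + κ ^ 2 * x := by linear_combination hB + κ * hv
  have d₂ : p * n * (x - y) = 2 * τ * (x + y) * (u - κ * z) := by
    rw [← hu, hA'] at hZ₁
    rw [hu', hB'] at hZ₂
    rw [hu', hA'] at h₅
    rw [← hu, hB'] at h₆
    subst hZ₁ hZ₂
    linear_combination x * h₅ - y * h₆ - p * (x - y) * hσ
  have d₃ : p * (x * y) = - u * (x + y) * (u - κ * z) := by
    apply mul_left_cancel₀ hN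
    apply mul_right_cancel₀ hxy'
    linear_combination x * y * d₂ + x * y * (x + y) * (u - κ * z) * hτ
      + n * (x + y) * (u - κ * z) * (ea + eb)
  have hxy'' : x + y ≠ 0 := by
    intro h'
    have : p * (x * y) = 0 := by rw [d₃, h']; ring
    exact mul_ne_zero hp hxy this
  apply hQ₀
  apply mul_right_cancel₀ hxy''
  linear_combination (x + y) * hQ - d₁ + 2 * d₃

/-- Eliminating `T = τ - σ (a + b)` between `t₁` and `t₂` gives a product equal to zero. Either
factor forces `a = b`, one through `T ≠ 0`, the other through `N ≠ 0`; then `d₁` reduces to `2 z a =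
κ (x - y)`. -/
theorem planar_of_factor {p κ x y z w v A B Z₁ Z₂ σ τ a b : F}
    (hv : v = w + κ * (x - y)) (hA : A = p - κ * v + κ ^ 2 * x) (hB : B = p + κ * v + κ ^ 2 * y)
    (hZ₁ : Z₁ = (x * a) ^ 2 + x * A) (hZ₂ : Z₂ = (y * b) ^ 2 + y * B)
    (g₁ : (σ - x * y * a * b) * b = a * (x * B) + τ)
    (g₂ : (σ - x * y * a * b) * a = b * (y * A) + τ)
    (h₄ : κ * (y * Z₁ - x * Z₂) - σ * (w + v) + 2 * τ * z = 0)
    (hv' : v = z * (a + b))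
    (ha : a ≠ 0) (hp₀ : p ≠ 0) (hκ : κ ≠ 0)
    (hN : σ - x * y * a * b + κ ^ 2 * (x * y) ≠ 0)
    (hT : τ - σ * (a + b) ≠ 0) (h : p + κ ^ 2 * (x + y) + κ * z * (a - b) = 0) :
    p = - κ ^ 2 * (x + y) ∧ w = 0 ∧ 2 * z * a = κ * (x - y) ∧ a = b := by
  obtain rfl : p = - κ ^ 2 * (x + y) - κ * z * (a - b) := by linear_combination h
  have hw : w = z * (a + b) - κ * (x - y) := by linear_combination hv' - hv
  have d₁ : (σ - x * y * a * b + κ ^ 2 * (x * y)) * (b - a) =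
      κ * (x + y) * (2 * z * a * b - κ * (x * a - y * b)) := by
    subst hA hB hv'
    linear_combination g₁ - g₂
  have t₁ : (a - b) * (τ - σ * (a + b)) = - (a * b) * (x * y * (a ^ 2 - b ^ 2)
      + κ ^ 2 * (x ^ 2 - y ^ 2) - 2 * κ * z * (a * y + b * x)) := by
    subst hA hB hv'
    linear_combination (b - a) * g₁ + a * d₁
  have t₂ : 2 * z * (a - b) * (τ - σ * (a + b)) = - κ * (x * a - y * b) *
      (x * y * (a ^ 2 - b ^ 2) + κ ^ 2 * (x ^ 2 - y ^ 2) - 2 * κ * z * (a * y + b * x)) := by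
    subst hA hB hv' hw hZ₁ hZ₂
    linear_combination (a - b) * h₄ + κ * (x - y) * d₁
  have e : (x * y * (a ^ 2 - b ^ 2) + κ ^ 2 * (x ^ 2 - y ^ 2) - 2 * κ * z * (a * y + b * x)) *
      (2 * z * a * b - κ * (x * a - y * b)) = 0 := by
    linear_combination 2 * z * t₁ - t₂
  have hab : a = b := by
    rcases mul_eq_zero.1 e with e | e
    · have : (a - b) * (τ - σ * (a + b)) = 0 := by rw [t₁, e, mul_zero]
      simpa [hT, sub_eq_zero] using this
    · have : (σ - x * y * a * b + κ ^ 2 * (x * y)) * (b - a) = 0 := by rw [d₁, e, mul_zero]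
      exact (sub_eq_zero.1 (by simpa [hN] using this)).symm
  subst hab
  have hxy : x + y ≠ 0 := by
    intro h'
    apply hp₀
    linear_combination -κ ^ 2 * h'
  have e₁ : 2 * z * a = κ * (x - y) := by
    apply mul_left_cancel₀ hxy
    apply mul_left_cancel₀ ha
    apply mul_left_cancel₀ hκ
    linear_combination -d₁
  refine ⟨by ring, ?_, e₁, rfl⟩
  linear_combination hw + e₁

/-- The case analysis of the critical relation with a nonzero coefficient at `dK`, where `K = Z₁ Z₂`.
The last two cases are families of points at which the momentum map has rank one. -/
theorem elimination {p κ x y z w v W₁ W₂ A B Z₁ Z₂ σ τ c s e l : F}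
    (hv : v = w + κ * (x - y)) (hA : A = p - κ * v + κ ^ 2 * x) (hB : B = p + κ * v + κ ^ 2 * y)
    (hZ₁ : Z₁ = W₁ ^ 2 + x * A) (hZ₂ : Z₂ = W₂ ^ 2 + y * B)
    (he : e = x * y + z ^ 2) (hl : l = W₁ * y + W₂ * x + z * v)
    (hs : s = 2 * W₁ * W₂ + w ^ 2 - (x * A + y * B) - 2 * σ)
    (h₁ : W₁ * Z₂ - σ * W₂ + τ * y = 0) (h₂ : W₂ * Z₁ - σ * W₁ + τ * x = 0)
    (h₃ : τ * v + c * z = 0)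
    (h₄ : κ * (y * Z₁ - x * Z₂) - σ * (w + v) + 2 * τ * z = 0)
    (h₅ : A * Z₂ + κ ^ 2 * y * Z₁ + σ * (A + κ ^ 2 * y) + 2 * τ * (W₂ + κ * z) + c * y = 0)
    (h₆ : B * Z₁ + κ ^ 2 * x * Z₂ + σ * (B + κ ^ 2 * x) + 2 * τ * (W₁ - κ * z) + c * x = 0)
    (hp : p ≠ 0) (hκ : κ ≠ 0) (he₀ : e ≠ 0) (hxy : x = 0 ↔ y = 0) (hW : W₁ = 0 ↔ W₂ = 0)
    (hK₀ : Z₁ * Z₂ ≠ 0) :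
    (τ = 0 ∧ p ^ 2 - κ ^ 2 * s = 0 ∧ Z₁ * Z₂ = σ ^ 2) ∨
    (e * s = l ^ 2 ∧ e * τ = σ * l ∧ Z₁ * Z₂ = σ ^ 2) ∨
    (∀ t, -2 * p * t = W₁ + W₂ → τ = (p ^ 2 - κ ^ 2 * s) * t ∧ l = t * s ∧
      σ = p ^ 2 * t ^ 2 - κ ^ 2 * e ∧
      Z₁ * Z₂ = σ ^ 2 + (p ^ 2 - κ ^ 2 * s) * (e - t ^ 2 * s)) ∨
    (x = y ∧ z = 0 ∧ w = 0 ∧ W₁ = W₂) ∨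
    (p = - κ ^ 2 * (x + y) ∧ w = 0 ∧ z ≠ 0 ∧
      2 * z * W₁ = κ * (x - y) * x ∧ 2 * z * W₂ = κ * (x - y) * y) := by
  have hZ₁₀ := left_ne_zero_of_mul hK₀
  have hZ₂₀ := right_ne_zero_of_mul hK₀
  by_cases hK : Z₁ * Z₂ = σ ^ 2
  · have hσ : σ ≠ 0 := by
      rintro rfl
      exact hK₀ (by rw [hK]; ring)
    by_cases hτ : τ = 0
    · subst hτ
      simp only [zero_mul, mul_zero, add_zero, zero_add] at h₁ h₂ h₃ h₄ h₅ h₆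
      by_cases hc : c = 0
      · subst hc
        simp only [zero_mul, add_zero] at h₅ h₆
        by_cases hu : Z₁ + σ = 0
        · have := area_eq_zero_of_Z_eq_neg (z := z) hv hA hB hZ₁ hZ₂ h₁ h₄ hp hσ hK hu
          rw [← hl, ← hs] at this
          right; left
          exact ⟨by rw [this.1, this.2]; ring, by rw [this.1]; ring, hK⟩
        · have := resonance_of_add_ne_zero hv hA hB hZ₁ h₁ h₅ h₆ hσ hK hu
          rw [← hs] at this
          exact Or.inl ⟨rfl, this, hK⟩
      · have hz : z = 0 := by simpa [hc] using h₃
        have hx : x ≠ 0 := by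
          rintro rfl
          exact he₀ (by rw [he, hz]; ring)
        have := collinear_of_Z_mul_Z_eq_sq hv hA hB hZ₁ hZ₂ h₁ h₂ h₄ h₅ h₆ hx (hxy.not.1 hx) hσ hc hK
        exact Or.inr (Or.inr (Or.inr (Or.inl ⟨this.1, hz, this.2⟩)))
    · right; left
      have key : e * τ = σ * l ∧ e * s = l ^ 2 := by
        rw [he, hl, hs]
        by_cases hx : x = 0
        · exact area_relations_of_eq_zero hv hZ₁ hZ₂ h₁ h₄ hx (hxy.1 hx) hσ hK
        · have e₁ := mul_eq_zero_of_Z_mul_Z_eq_sq h₁ h₂ hK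
          have e₂ := mul_eq_zero_of_Z_mul_Z_eq_sq h₂ h₁ (by rw [mul_comm, hK])
          exact area_relations_of_ne_zero hv hA hB hZ₁ hZ₂ h₁ h₄ hx (hxy.not.1 hx) hσ
            ((mul_eq_zero.1 e₁).resolve_left hτ) ((mul_eq_zero.1 e₂).resolve_left hτ)
      exact ⟨key.2, key.1, hK⟩
  right; right
  have hK' : Z₁ * Z₂ - σ ^ 2 ≠ 0 := sub_ne_zero.2 hK
  by_cases hτ : τ = 0
  · subst hτ
    have w₁ : W₁ = 0 := by
      have := W_mul_sub_eq h₁ h₂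
      simpa [hK'] using this
    have w₂ := hW.1 w₁
    subst w₁ w₂
    simp only [zero_mul, mul_zero, add_zero, zero_add, ne_eq, OfNat.ofNat_ne_zero,
      not_false_eq_true, zero_pow] at h₃ h₄ h₅ h₆ hZ₁ hZ₂ hs
    subst hZ₁ hZ₂
    rcases cases_of_W_eq_zero hv hA hB h₃ h₄ h₅ h₆ hK₀ hK with h | h | h
    · left
      intro t ht
      obtain rfl : t = 0 := by simpa [hp] using ht
      obtain ⟨hz, hσ, h⟩ := h
      refine ⟨by ring, by rw [hl, hz]; ring, by rw [hσ, he, hz]; ring, ?_⟩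
      rw [h, he, hs, hz]
      ring
    · right; left
      exact ⟨h.1, h.2.1, h.2.2, rfl⟩
    · right; right
      exact ⟨h.1, h.2.1, h.2.2.1, by rw [h.2.2.2]; ring, by rw [h.2.2.2]; ring⟩
  -- On the vertical axis `Zᵢ = Wᵢ²` and `σ = W₁ W₂`, contrary to `k ≠ σ²`.
  have hx : x ≠ 0 := by
    intro hx
    have hy := hxy.1 hx
    subst hx hy
    simp only [zero_mul, mul_zero, add_zero] at hZ₁ hZ₂ h₁
    subst hZ₁ hZ₂
    apply hK'
    have : σ = W₁ * W₂ := by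
      apply mul_right_cancel₀ (pow_ne_zero_iff two_ne_zero |>.1 hZ₂₀)
      linear_combination -h₁
    rw [this]
    ring
  have hy := hxy.not.1 hx
  by_cases hN : σ - W₁ * W₂ + κ ^ 2 * (x * y) = 0
  · left
    intro t ht
    have := double_root_relations hv hA hB hZ₁ hZ₂ h₁ h₂ h₄ hx hy hτ hp hN ht
    simp only [← hs, ← hl, ← he] at this
    exact this
  right
  have hf := factorization hv hA hB hZ₁ hZ₂ h₁ h₂ h₃ h₄ h₅ h₆ hZ₁₀
  replace hf := (mul_eq_zero.1 hf).resolve_left hN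
  obtain ⟨a, rfl⟩ : ∃ a, W₁ = x * a := ⟨W₁ / x, by field_simp⟩
  obtain ⟨b, rfl⟩ : ∃ b, W₂ = y * b := ⟨W₂ / y, by field_simp⟩
  have hab : a = 0 ↔ b = 0 := by simpa [hx, hy] using hW
  have hv' : v = z * (a + b) := by
    apply mul_right_cancel₀ (mul_ne_zero hx hy)
    linear_combination hf
  have g₁ : (σ - x * y * a * b) * b = a * (x * B) + τ := by
    apply mul_left_cancel₀ hy
    linear_combination -h₁ + x * a * hZ₂
  have g₂ : (σ - x * y * a * b) * a = b * (y * A) + τ := by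
    apply mul_left_cancel₀ hx
    linear_combination -h₂ + y * b * hZ₁
  have ha : a ≠ 0 := by
    intro h
    have hb := hab.1 h
    apply hτ
    rw [h, hb] at g₁
    linear_combination -g₁
  have hb := hab.not.1 ha
  have hN' : σ - x * y * a * b + κ ^ 2 * (x * y) ≠ 0 := by
    intro h; apply hN; linear_combination h
  -- Equality would give `x Z₂ = -σ y` and `y Z₁ = -σ x`, hence `k = σ²`.
  have hT : τ - σ * (a + b) ≠ 0 := by
    intro h
    have t₁ : σ + x * y * b ^ 2 + x * B = 0 := by
      apply mul_left_cancel₀ ha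
      linear_combination -g₁ - h
    have t₂ : σ + x * y * a ^ 2 + y * A = 0 := by
      apply mul_left_cancel₀ hb
      linear_combination -g₂ - h
    apply hK'
    apply mul_left_cancel₀ (mul_ne_zero hx hy)
    have e₁ : x * Z₂ = - σ * y := by linear_combination x * hZ₂ + y * t₁
    have e₂ : y * Z₁ = - σ * x := by linear_combination y * hZ₁ + x * t₂
    linear_combination y * Z₁ * e₁ - σ * y * e₂
  by_cases hz : z = 0
  · left
    subst hz
    simp only [mul_zero, add_zero, sub_zero, zero_mul] at h₄ h₅ h₆ hv'
    have := collinear_of_z_eq_zero hv hA hB hZ₁ hZ₂ g₁ g₂ h₄ h₅ h₆ hv' hx hy ha hκ hp hN'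
      (sub_ne_zero.1 hT)
    exact ⟨this.1, rfl, this.2.1, by rw [this.1, this.2.2]⟩
  · right
    have hc : c = - τ * (a + b) := by
      apply mul_left_cancel₀ hz
      linear_combination h₃ - τ * hv'
    have := common_factor hA hB hZ₁ hZ₂ g₁ g₂ h₅ h₆ hv' hc hT
    rcases mul_eq_zero.1 this with h | h
    · exact (false_of_antisymmetric hv hA hB hZ₁ hZ₂ g₁ g₂ h₄ h₅ h₆ hv' hx hy ha hp hN' hT h).elim
    · obtain ⟨k₁, k₂, k₃, k₄⟩ := planar_of_factor hv hA hB hZ₁ hZ₂ g₁ g₂ h₄ hv' ha hp hκ hN' hT h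
      refine ⟨k₁, k₂, hz, ?_, ?_⟩
      · linear_combination x * k₃
      · rw [← k₄]
        linear_combination y * k₃

/-- The critical relation in complex coordinates. -/
theorem complex_relations {i p q M₁ M₂ M₃ α₁ α₂ α₃ U V σ τ c x y κ w v W₁ W₂ A B Z₁ Z₂ C : F}
    (hi : i ^ 2 = -1) (hx : x = α₁ + i * α₂) (hy : y = α₁ - i * α₂) (hκ : κ = i * q)
    (hw : w = M₃) (hW₁ : W₁ = M₁ / 2 + i * (M₂ / 2 + q * α₃))
    (hW₂ : W₂ = M₁ / 2 - i * (M₂ / 2 + q * α₃))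
    (hv : v = w + κ * (x - y)) (hA : A = p - κ * v + κ ^ 2 * x) (hB : B = p + κ * v + κ ^ 2 * y)
    (hZ₁ : Z₁ = U + i * V) (hZ₂ : Z₂ = U - i * V) (hC : C = c + 2 * σ * q ^ 2)
    (h₁ : U * M₁ + 2 * V * (M₂ / 2 + q * α₃) - σ * M₁ + 2 * τ * α₁ = 0)
    (h₂ : V * M₁ - 2 * U * (M₂ / 2 + q * α₃) - 2 * σ * (M₂ / 2 + q * α₃) + 2 * τ * α₂ = 0)
    (h₃ : U * q * α₂ - V * q * α₁ - σ * (M₃ - q * α₂) + τ * α₃ = 0)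
    (h₄ : U * (p - 2 * q ^ 2 * α₁) - V * q * M₃ + σ * p + τ * M₁ + c * α₁ = 0)
    (h₅ : U * (q * M₃ - 2 * q ^ 2 * α₂) + V * p + σ * q * M₃ + τ * M₂ + c * α₂ = 0)
    (h₆ : - U * (q * M₂ + 2 * q ^ 2 * α₃) + V * q * M₁ - σ * q * M₂ + τ * M₃ + c * α₃ = 0) :
    W₁ * Z₂ - σ * W₂ + τ * y = 0 ∧ W₂ * Z₁ - σ * W₁ + τ * x = 0 ∧
    τ * v + C * α₃ = 0 ∧
    κ * (y * Z₁ - x * Z₂) - σ * (w + v) + 2 * τ * α₃ = 0 ∧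
    A * Z₂ + κ ^ 2 * y * Z₁ + σ * (A + κ ^ 2 * y) + 2 * τ * (W₂ + κ * α₃) + C * y = 0 ∧
    B * Z₁ + κ ^ 2 * x * Z₂ + σ * (B + κ ^ 2 * x) + 2 * τ * (W₁ - κ * α₃) + C * x = 0 := by
  subst hx hy hκ hw hW₁ hW₂ hA hB hZ₁ hZ₂ hC
  obtain rfl : v = w - 2 * q * α₂ := by linear_combination hv + 2 * q * α₂ * hi
  clear hv
  refine ⟨?_, ?_, ?_, ?_, ?_, ?_⟩
  · linear_combination (h₁ - i * h₂) / 2 - (M₂ / 2 + q * α₃) * V * hi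
  · linear_combination (h₁ + i * h₂) / 2 - (M₂ / 2 + q * α₃) * V * hi
  -- `W₁, W₂` contain `α₃` through `M₂ / 2 + q α₃`; this combination is half the derivative along
  -- `∂/∂α₃ - 2q ∂/∂M₂`, which keeps them fixed.
  · linear_combination (norm := skip) h₆ - q * h₂
    clear h₁ h₂ h₃ h₄ h₅ h₆
    grind
  · linear_combination (norm := skip) 2 * h₃
    clear h₁ h₂ h₃ h₄ h₅ h₆
    grind
  · linear_combination (norm := skip) h₄ - i * h₅
    clear h₁ h₂ h₃ h₄ h₅ h₆
    grind
  · linear_combination (norm := skip) h₄ + i * h₅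
    clear h₁ h₂ h₃ h₄ h₅ h₆
    grind

/-- The integrals in complex coordinates. -/
theorem complex_integrals {i p q M₁ M₂ M₃ α₁ α₂ α₃ x y κ w v W₁ W₂ A B : F}
    (hi : i ^ 2 = -1) (hx : x = α₁ + i * α₂) (hy : y = α₁ - i * α₂) (hκ : κ = i * q)
    (hw : w = M₃) (hW₁ : W₁ = M₁ / 2 + i * (M₂ / 2 + q * α₃))
    (hW₂ : W₂ = M₁ / 2 - i * (M₂ / 2 + q * α₃))
    (hv : v = w + κ * (x - y)) (hA : A = p - κ * v + κ ^ 2 * x) (hB : B = p + κ * v + κ ^ 2 * y) :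
    W₁ ^ 2 + x * A = ((M₁ ^ 2 - M₂ ^ 2) / 4 + q * (α₂ * M₃ - α₃ * M₂)
        - q ^ 2 * (α₁ ^ 2 + α₂ ^ 2 + α₃ ^ 2) + p * α₁)
      + i * (M₁ * M₂ / 2 + q * (α₃ * M₁ - α₁ * M₃) + p * α₂) ∧
    W₂ ^ 2 + y * B = ((M₁ ^ 2 - M₂ ^ 2) / 4 + q * (α₂ * M₃ - α₃ * M₂)
        - q ^ 2 * (α₁ ^ 2 + α₂ ^ 2 + α₃ ^ 2) + p * α₁)
      - i * (M₁ * M₂ / 2 + q * (α₃ * M₁ - α₁ * M₃) + p * α₂) ∧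
    2 * W₁ * W₂ + w ^ 2 - (x * A + y * B) = 2 * (((M₁ ^ 2 + M₂ ^ 2 + 2 * M₃ ^ 2) / 4
      + q * (α₃ * M₂ - α₂ * M₃) - p * α₁) + q ^ 2 * (α₁ ^ 2 + α₂ ^ 2 + α₃ ^ 2)) ∧
    W₁ * y + W₂ * x + α₃ * v = M₁ * α₁ + M₂ * α₂ + M₃ * α₃ ∧
    x * y + α₃ ^ 2 = α₁ ^ 2 + α₂ ^ 2 + α₃ ^ 2 := by
  subst hx hy hκ hw hW₁ hW₂ hA hB
  obtain rfl : v = w - 2 * q * α₂ := by linear_combination hv + 2 * q * α₂ * hi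
  clear hv
  refine ⟨?_, ?_, ?_, ?_, ?_⟩
  · grind
  · grind
  · grind
  · grind
  · grind

end Elimination

/-! ### Explicit differentials of the integrals and of the generating functions. -/

/-- The differential of `Γ`. -/
def dGam (x v : Phase) : ℝ := 2 * (x.2 0 * v.2 0 + x.2 1 * v.2 1 + x.2 2 * v.2 2)

/-- The differential of `L`. -/
def dL (x v : Phase) : ℝ :=
  (x.2 0 * v.1 0 + x.2 1 * v.1 1 + x.2 2 * v.1 2
    + x.1 0 * v.2 0 + x.1 1 * v.2 1 + x.1 2 * v.2 2) / 2

/-- The differential of `H`. -/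
def dH (p q : ℝ) (x v : Phase) : ℝ :=
  x.1 0 / 2 * v.1 0 + (x.1 1 / 2 + q * x.2 2) * v.1 1 + (x.1 2 - q * x.2 1) * v.1 2
    - p * v.2 0 - q * x.1 2 * v.2 1 + q * x.1 1 * v.2 2

/-- The real part of the complex function whose squared modulus is `K`. -/
def reK (p q : ℝ) (x : Phase) : ℝ :=
  (x.1 0 ^ 2 - x.1 1 ^ 2) / 4 + q * (x.2 1 * x.1 2 - x.2 2 * x.1 1)
      - q ^ 2 * (x.2 0 ^ 2 + x.2 1 ^ 2 + x.2 2 ^ 2) + p * x.2 0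

/-- The imaginary part of the complex function whose squared modulus is `K`. -/
def imK (p q : ℝ) (x : Phase) : ℝ :=
  x.1 0 * x.1 1 / 2 + q * (x.2 2 * x.1 0 - x.2 0 * x.1 2) + p * x.2 1

/-- The differential of `K`. -/
def dK (p q : ℝ) (x v : Phase) : ℝ :=
  2 * reK p q x * (x.1 0 / 2 * v.1 0 - (x.1 1 / 2 + q * x.2 2) * v.1 1 + q * x.2 1 * v.1 2
      + (p - 2 * q ^ 2 * x.2 0) * v.2 0 + (q * x.1 2 - 2 * q ^ 2 * x.2 1) * v.2 1
      - (q * x.1 1 + 2 * q ^ 2 * x.2 2) * v.2 2)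
    + 2 * imK p q x * ((x.1 1 / 2 + q * x.2 2) * v.1 0 + x.1 0 / 2 * v.1 1 - q * x.2 0 * v.1 2
      - q * x.1 2 * v.2 0 + p * v.2 1 + q * x.1 0 * v.2 2)

theorem differentiable_Gam : Differentiable ℝ Gam := by
  unfold Gam; fun_prop

theorem differentiable_L : Differentiable ℝ L := by
  unfold L; fun_prop

theorem differentiable_H (p q : ℝ) : Differentiable ℝ (H p q) := by
  unfold H; fun_prop

theorem differentiable_K (p q : ℝ) : Differentiable ℝ (K p q) := by
  unfold K; fun_prop

/-- The derivative of a function along a line. -/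
theorem fderiv_apply_of_hasDerivAt_line {f : Phase → ℝ} {x v : Phase} {d : ℝ}
    (hf : DifferentiableAt ℝ f x)
    (hd : HasDerivAt (fun t : ℝ => f (x + t • v)) d 0) : fderiv ℝ f x v = d := by
  rw [← hf.lineDeriv_eq_fderiv]
  exact hd.deriv

theorem hasDerivAt_line_fst (x v : Phase) (i : Fin 3) :
    HasDerivAt (fun t : ℝ => (x + t • v).1 i) (v.1 i) 0 := by
  simpa using ((hasDerivAt_id (0 : ℝ)).mul_const (v.1 i)).const_add (x.1 i)

theorem hasDerivAt_line_snd (x v : Phase) (i : Fin 3) :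
    HasDerivAt (fun t : ℝ => (x + t • v).2 i) (v.2 i) 0 := by
  simpa using ((hasDerivAt_id (0 : ℝ)).mul_const (v.2 i)).const_add (x.2 i)

theorem fderiv_Gam (x v : Phase) : fderiv ℝ Gam x v = dGam x v := by
  refine fderiv_apply_of_hasDerivAt_line (differentiable_Gam x) ?_
  have h := fun i => hasDerivAt_line_snd x v i
  refine ((((h 0).pow 2).add ((h 1).pow 2)).add ((h 2).pow 2)).congr_deriv ?_
  simp [dGam]
  ring

theorem fderiv_L (x v : Phase) : fderiv ℝ L x v = dL x v := by
  refine fderiv_apply_of_hasDerivAt_line (differentiable_L x) ?_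
  have h := fun i => hasDerivAt_line_snd x v i
  have g := fun i => hasDerivAt_line_fst x v i
  refine (((((g 0).mul (h 0)).add ((g 1).mul (h 1))).add ((g 2).mul (h 2))).div_const 2).congr_deriv
    ?_
  simp [dL]
  ring

theorem fderiv_H (p q : ℝ) (x v : Phase) : fderiv ℝ (H p q) x v = dH p q x v := by
  refine fderiv_apply_of_hasDerivAt_line (differentiable_H p q x) ?_
  have h := fun i => hasDerivAt_line_snd x v i
  have g := fun i => hasDerivAt_line_fst x v i
  refine ((((((g 0).pow 2).add ((g 1).pow 2)).add (((g 2).pow 2).const_mul 2)).div_const 4).add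
    ((((h 2).mul (g 1)).sub ((h 1).mul (g 2))).const_mul q) |>.sub ((h 0).const_mul p)).congr_deriv ?_
  simp [dH]
  ring

theorem fderiv_K (p q : ℝ) (x v : Phase) : fderiv ℝ (K p q) x v = dK p q x v := by
  refine fderiv_apply_of_hasDerivAt_line (differentiable_K p q x) ?_
  have h := fun i => hasDerivAt_line_snd x v i
  have g := fun i => hasDerivAt_line_fst x v i
  refine (((((((g 0).pow 2).sub ((g 1).pow 2)).div_const 4).add
    ((((h 1).mul (g 2)).sub ((h 2).mul (g 1))).const_mul q) |>.sub
      (((((h 0).pow 2).add ((h 1).pow 2)).add ((h 2).pow 2)).const_mul (q ^ 2)) |>.add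
      ((h 0).const_mul p)).pow 2).add
    ((((((g 0).mul (g 1)).div_const 2).add
      ((((h 2).mul (g 0)).sub ((h 0).mul (g 2))).const_mul q)).add
      ((h 1).const_mul p)).pow 2)).congr_deriv ?_
  simp [dK, reK, imK]
  ring

theorem mem_tangent {x v : Phase} : v ∈ tangent x ↔ dGam x v = 0 := by
  rw [← fderiv_Gam]; rfl

theorem K_eq (p q : ℝ) (x : Phase) : K p q x = reK p q x ^ 2 + imK p q x ^ 2 := rfl

theorem fderiv_momentum (p q : ℝ) (x v : Phase) :
    fderiv ℝ (momentum p q) x v = (dH p q x v, dL x v, dK p q x v) := by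
  have h := (differentiable_H p q x).hasFDerivAt.prodMk
    ((differentiable_L x).hasFDerivAt.prodMk (differentiable_K p q x).hasFDerivAt)
  have : fderiv ℝ (momentum p q) x = _ := h.fderiv
  rw [this]
  simp [fderiv_H, fderiv_L, fderiv_K]

theorem fderiv_Phi1_comp (p q : ℝ) (x v : Phase) :
    fderiv ℝ (fun y => Phi1 (momentum p q y)) x v = dK p q x v :=
  fderiv_K p q x v

theorem fderiv_Phi2_comp (a p q : ℝ) (hq : q ≠ 0) (x v : Phase) :
    fderiv ℝ (fun y => Phi2 a p q (momentum p q y)) x v =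
      dK p q x v - 2 * (H p q x + q ^ 2 * a ^ 2 + p ^ 2 / (2 * q ^ 2)) * dH p q x v := by
  have hH := (differentiable_H p q x).hasFDerivAt
  have hK := (differentiable_K p q x).hasFDerivAt
  have h := hK.sub (((((hH.add_const (q ^ 2 * a ^ 2)).const_mul (2 * q ^ 2)).add_const
    (p ^ 2)).pow 2).const_mul (1 / (4 * q ^ 4)))
  have : fderiv ℝ (fun y => Phi2 a p q (momentum p q y)) x = _ := h.fderiv
  rw [this]
  simp [fderiv_H, fderiv_K]
  field_simp
  ring

theorem fderiv_Phi3_comp (a p q : ℝ) (ha : a ≠ 0) (x v : Phase) :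
    fderiv ℝ (fun y => Phi3 a q (momentum p q y)) x v =
      dK p q x v - 2 * (H p q x + q ^ 2 * a ^ 2 - 2 * L x ^ 2 / a ^ 2) *
        (dH p q x v - 4 * L x / a ^ 2 * dL x v) := by
  have hH := (differentiable_H p q x).hasFDerivAt
  have hL := (differentiable_L x).hasFDerivAt
  have hK := (differentiable_K p q x).hasFDerivAt
  have h := hK.sub (((((hH.add_const (q ^ 2 * a ^ 2)).const_mul (a ^ 2)).sub
    ((hL.pow 2).const_mul 2)).pow 2).mul_const (a ^ 4)⁻¹)
  have : fderiv ℝ (fun y => Phi3 a q (momentum p q y)) x = _ := h.fderiv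
  rw [this]
  simp [fderiv_H, fderiv_K, fderiv_L]
  field_simp
  ring

/-! ### Critical points and linear relations between differentials. -/

/-- At a critical point, the differentials of `K, H, L, Γ` satisfy a nontrivial relation. -/
theorem exists_relation {a p q : ℝ} (ha : a ≠ 0) {x : Phase} (hx : x ∈ criticalSet a p q) :
    ∃ c₀ c₁ c₂ c₃ : ℝ, (c₀ ≠ 0 ∨ c₁ ≠ 0 ∨ c₂ ≠ 0) ∧
      ∀ v, c₀ * dK p q x v + c₁ * dH p q x v + c₂ * dL x v + c₃ * dGam x v = 0 := by
  obtain ⟨hΓ, hx⟩ := hx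
  obtain ⟨f, hf₀, hf⟩ := Submodule.exists_le_ker_of_lt_top _ (lt_top_iff_ne_top.2 hx)
  have hfe : ∀ u : ℝ × ℝ × ℝ, f u = u.2.2 * f (0, 0, 1) + u.1 * f (1, 0, 0) + u.2.1 * f (0, 1, 0) := by
    rintro ⟨u₁, u₂, u₃⟩
    rw [← smul_eq_mul, ← smul_eq_mul, ← smul_eq_mul, ← map_smul, ← map_smul, ← map_smul, ← map_add,
      ← map_add]
    simp
  have hker : ∀ v, dGam x v = 0 → f (dH p q x v, dL x v, dK p q x v) = 0 := by
    intro v hv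
    rw [← fderiv_momentum]
    exact hf ⟨v, mem_tangent.2 hv, rfl⟩
  have hn : dGam x (0, x.2) ≠ 0 := by
    have : dGam x (0, x.2) = 2 * a ^ 2 := by
      rw [← show Gam x = a ^ 2 from hΓ]
      simp only [dGam, Gam]
      ring
    rw [this]
    positivity
  -- The vector `(0, α)` is transversal to `P⁵`, as `dΓ` takes the value `2a²` on it. The last
  -- coefficient makes the relation hold on this vector too, hence everywhere.
  refine ⟨f (0, 0, 1), f (1, 0, 0), f (0, 1, 0),
    - f (dH p q x (0, x.2), dL x (0, x.2), dK p q x (0, x.2)) / dGam x (0, x.2), ?_, fun v => ?_⟩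
  · by_contra! h
    apply hf₀
    refine LinearMap.ext fun u => ?_
    rw [hfe, h.1, h.2.1, h.2.2]
    simp
  · have := hker (v - (dGam x v / dGam x (0, x.2)) • (0, x.2)) (by
      have e : ∀ r : ℝ, dGam x (v - r • (0, x.2)) = dGam x v - r * dGam x (0, x.2) := by
        intro r; simp [dGam]; ring
      rw [e]
      field_simp
      ring)
    have eH : ∀ r : ℝ, dH p q x (v - r • (0, x.2)) = dH p q x v - r * dH p q x (0, x.2) := by
      intro r; simp [dH]; ring
    have eL : ∀ r : ℝ, dL x (v - r • (0, x.2)) = dL x v - r * dL x (0, x.2) := by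
      intro r; simp [dL]; ring
    have eK : ∀ r : ℝ, dK p q x (v - r • (0, x.2)) = dK p q x v - r * dK p q x (0, x.2) := by
      intro r; simp [dK]; ring
    rw [eH, eL, eK, hfe] at this
    rw [hfe (dH p q x (0, x.2), dL x (0, x.2), dK p q x (0, x.2))]
    simp only at this ⊢
    linear_combination this

theorem mem_criticalSet {a p q : ℝ} {x : Phase} (hx : x ∈ P5 a) {c₁ c₂ : ℝ}
    (h : ∀ v ∈ tangent x, dK p q x v + c₁ * dH p q x v + c₂ * dL x v = 0) :
    x ∈ criticalSet a p q := by
  refine ⟨hx, fun htop => ?_⟩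
  have : ((0, 0, 1) : ℝ × ℝ × ℝ) ∈ (tangent x).map (fderiv ℝ (momentum p q) x).toLinearMap :=
    htop ▸ Submodule.mem_top
  obtain ⟨v, hv, e⟩ := this
  have e' : fderiv ℝ (momentum p q) x v = (0, 0, 1) := e
  rw [fderiv_momentum] at e'
  simp only [Prod.mk.injEq] at e'
  have := h v hv
  rw [e'.1, e'.2.1, e'.2.2] at this
  simp at this

theorem solutions1_subset {a p q : ℝ} : solutions a p q Phi1 ⊆ criticalSet a p q := by
  rintro x ⟨hx, -, h⟩
  refine mem_criticalSet hx (c₁ := 0) (c₂ := 0) fun v hv => ?_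
  have := h v hv
  rw [fderiv_Phi1_comp] at this
  linear_combination this

theorem solutions2_subset {a p q : ℝ} (hq : q ≠ 0) :
    solutions a p q (Phi2 a p q) ⊆ criticalSet a p q := by
  rintro x ⟨hx, -, h⟩
  refine mem_criticalSet hx (c₁ := -2 * (H p q x + q ^ 2 * a ^ 2 + p ^ 2 / (2 * q ^ 2))) (c₂ := 0)
    fun v hv => ?_
  have := h v hv
  rw [fderiv_Phi2_comp a p q hq] at this
  linear_combination this

theorem solutions3_subset {a p q : ℝ} (ha : a ≠ 0) :
    solutions a p q (Phi3 a q) ⊆ criticalSet a p q := by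
  rintro x ⟨hx, -, h⟩
  refine mem_criticalSet hx (c₁ := -2 * (H p q x + q ^ 2 * a ^ 2 - 2 * L x ^ 2 / a ^ 2))
    (c₂ := 2 * (H p q x + q ^ 2 * a ^ 2 - 2 * L x ^ 2 / a ^ 2) * (4 * L x / a ^ 2)) fun v hv => ?_
  rw [← h v hv, fderiv_Phi3_comp a p q ha]
  ring

theorem solutions4_subset {a p q : ℝ} : solutions4 a p q ⊆ criticalSet a p q := by
  rintro x ⟨hx, s, t, -, -, -, h⟩
  refine mem_criticalSet hx (c₁ := -2 * (H p q x + q ^ 2 * a ^ 2 - s))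
    (c₂ := 4 * (p ^ 2 + 2 * q ^ 2 * s) * t) fun v hv => ?_
  rw [← h v hv, fderiv_K, fderiv_H, fderiv_L]
  ring

/-- `K` is a sum of two squares, so both vanish with it, and `dK = 0` follows. -/
theorem mem_solutions1 {a p q : ℝ} {x : Phase} (hx : x ∈ P5 a) (hK : K p q x = 0) :
    x ∈ solutions a p q Phi1 := by
  refine ⟨hx, hK, fun v _ => ?_⟩
  rw [K_eq] at hK
  have h₁ : reK p q x = 0 := by nlinarith [sq_nonneg (reK p q x), sq_nonneg (imK p q x)]
  have h₂ : imK p q x = 0 := by nlinarith [sq_nonneg (reK p q x), sq_nonneg (imK p q x)]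
  rw [fderiv_Phi1_comp, dK, h₁, h₂]
  ring

theorem mem_solutions2 {a p q σ : ℝ} (hq : q ≠ 0) {x : Phase} (hx : x ∈ P5 a)
    (hσ : σ = H p q x + q ^ 2 * a ^ 2 + p ^ 2 / (2 * q ^ 2)) (hK : K p q x = σ ^ 2)
    (h : ∀ v ∈ tangent x, dK p q x v - 2 * σ * dH p q x v = 0) :
    x ∈ solutions a p q (Phi2 a p q) := by
  refine ⟨hx, ?_, fun v hv => ?_⟩
  · simp only [Phi2, momentum, hK, hσ]
    field_simp
    ring
  · rw [fderiv_Phi2_comp a p q hq, ← hσ, h v hv]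

/-- With `s = h + q² a² - σ`, the hypotheses read `a² s = 2ℓ²`, `P(s) = 0`, and `τ` is the
coefficient produced by differentiating `Φ₃`. -/
theorem mem_solutions3 {a p q σ τ : ℝ} (ha : a ≠ 0) {x : Phase} (hx : x ∈ P5 a)
    (hσ : a ^ 2 * (H p q x + q ^ 2 * a ^ 2 - σ) = 2 * L x ^ 2) (hτ : a ^ 2 * τ = 2 * L x * σ)
    (hK : K p q x = σ ^ 2)
    (h : ∀ v ∈ tangent x, dK p q x v - 2 * σ * dH p q x v + 4 * τ * dL x v = 0) :
    x ∈ solutions a p q (Phi3 a q) := by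
  have hσ' : σ = H p q x + q ^ 2 * a ^ 2 - 2 * L x ^ 2 / a ^ 2 := by
    rw [← hσ]
    field_simp
    ring
  have hτ' : τ = σ * (2 * L x / a ^ 2) := by
    field_simp
    linear_combination hτ
  refine ⟨hx, ?_, fun v hv => ?_⟩
  · simp only [Phi3, momentum, hK]
    rw [hσ']
    field_simp
    ring
  · rw [fderiv_Phi3_comp a p q ha, ← hσ', ← h v hv, hτ']
    ring

/-- Under `ℓ = t s`, the hypothesis `hK` is `φ(s) = 0` divided by `s`, and `hσ` is then `φ'(s) = 0`
divided by `2s`; in this form they make sense for `s = 0`. -/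
theorem mem_solutions4 {a p q σ τ s t : ℝ} (hp : p ≠ 0) {x : Phase} (hx : x ∈ P5 a)
    (hs : s = H p q x + q ^ 2 * a ^ 2 - σ) (hτ : τ = (p ^ 2 + 2 * q ^ 2 * s) * t)
    (hL : L x = t * s) (hσ : σ = p ^ 2 * t ^ 2 + q ^ 2 * a ^ 2)
    (hK : K p q x = σ ^ 2 + (p ^ 2 + 2 * q ^ 2 * s) * (a ^ 2 - 2 * t ^ 2 * s))
    (h : ∀ v ∈ tangent x, dK p q x v - 2 * σ * dH p q x v + 4 * τ * dL x v = 0) :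
    x ∈ solutions4 a p q := by
  have hH : H p q x = s + p ^ 2 * t ^ 2 := by linear_combination -hs + hσ
  refine ⟨hx, s, t, hL, by rw [hH]; ring, ?_, fun v hv => ?_⟩
  · rw [hK, hσ, hH, k4]
    field_simp
    ring
  · rw [fderiv_K, fderiv_H, fderiv_L, ← h v hv, hs, hτ, hs]
    ring

/-! ### Every critical point belongs to a critical subsystem. -/

/-- The union of the four critical subsystems. -/
def allSolutions (a p q : ℝ) : Set Phase :=
  solutions a p q Phi1 ∪ solutions a p q (Phi2 a p q) ∪ solutions a p q (Phi3 a q)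
    ∪ solutions4 a p q

theorem mem_solutions3_of_collinear {a p q : ℝ} (ha : a ≠ 0) {x : Phase} (hx : x ∈ P5 a)
    (h₁ : x.1 1 = 0) (h₂ : x.1 2 = 0) (h₃ : x.2 1 = 0) (h₄ : x.2 2 = 0) :
    x ∈ solutions a p q (Phi3 a q) := by
  have hΓ : a ^ 2 = x.2 0 ^ 2 := by
    rw [← show Gam x = a ^ 2 from hx, Gam, h₃, h₄]; ring
  have h₀ : x.2 0 ≠ 0 := by
    intro h
    apply ha
    simpa [h] using hΓ
  have hL : L x = x.1 0 * x.2 0 / 2 := by rw [L, h₁, h₂]; ring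
  have hH : H p q x = x.1 0 ^ 2 / 4 - p * x.2 0 := by rw [H, h₁, h₂, h₃, h₄]; ring
  -- `σ` and `τ` are forced by `a² s = 2ℓ²` and `a² τ = 2ℓσ`. On the tangent space `dα₁ = 0`, and
  -- `dK, dH, dL` are all proportional to `dM₁`.
  refine mem_solutions3 ha hx (σ := q ^ 2 * x.2 0 ^ 2 - x.1 0 ^ 2 / 4 - p * x.2 0)
    (τ := x.1 0 / x.2 0 * (q ^ 2 * x.2 0 ^ 2 - x.1 0 ^ 2 / 4 - p * x.2 0)) ?_ ?_ ?_ fun v hv => ?_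
  · rw [hΓ, hL, hH]; ring
  · rw [hΓ, hL]; field_simp
  · rw [K, h₁, h₂, h₃, h₄]; ring
  · have hv₀ : v.2 0 = 0 := by
      rw [mem_tangent, dGam, h₃, h₄] at hv
      simpa [h₀] using hv
    rw [dK, dH, dL, reK, imK, h₁, h₂, h₃, h₄, hv₀]
    field_simp
    ring

theorem mem_solutions3_of_planar {a p q : ℝ} (ha : a ≠ 0) {x : Phase} (hx : x ∈ P5 a)
    (h₀ : p = 2 * q ^ 2 * x.2 0) (h₁ : x.1 2 = 0) (h₂ : x.2 2 ≠ 0)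
    (h₃ : x.2 2 * x.1 0 = - 2 * q * x.2 0 * x.2 1)
    (h₄ : x.2 2 * x.1 1 = - 2 * q * (x.2 1 ^ 2 + x.2 2 ^ 2)) :
    x ∈ solutions a p q (Phi3 a q) := by
  have hΓ : a ^ 2 = x.2 0 ^ 2 + x.2 1 ^ 2 + x.2 2 ^ 2 := hx.symm
  have k₃ : x.1 0 = - 2 * q * x.2 0 * x.2 1 / x.2 2 := by field_simp; linear_combination h₃
  have k₄ : x.1 1 = - 2 * q * (x.2 1 ^ 2 + x.2 2 ^ 2) / x.2 2 := by
    field_simp; linear_combination h₄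
  have hL : L x = - q * x.2 1 * a ^ 2 / x.2 2 := by
    rw [L, h₁, k₃, k₄, hΓ]
    field_simp
    ring
  have hH : H p q x + q ^ 2 * a ^ 2 = q ^ 2 * a ^ 2 * (x.2 1 ^ 2 - x.2 2 ^ 2) / x.2 2 ^ 2
      + q ^ 2 * (x.2 1 ^ 2 + x.2 2 ^ 2) := by
    rw [H, h₁, k₃, k₄, hΓ, h₀]
    field_simp
    ring
  -- Again `σ` and `τ` are the values forced by `a² s = 2ℓ²` and `a² τ = 2ℓσ`.
  refine mem_solutions3 ha hx
    (σ := - q ^ 2 * (x.2 1 ^ 2 + x.2 2 ^ 2) * (x.2 0 ^ 2 + x.2 1 ^ 2) / x.2 2 ^ 2)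
    (τ := 2 * q ^ 3 * x.2 1 * (x.2 1 ^ 2 + x.2 2 ^ 2) * (x.2 0 ^ 2 + x.2 1 ^ 2) / x.2 2 ^ 3)
    ?_ ?_ ?_ fun v hv => ?_
  · rw [hH, hL, hΓ]
    field_simp
    ring
  · rw [hL]
    field_simp
  · rw [K, h₁, k₃, k₄, h₀]
    field_simp
    ring
  · have hv₀ : v.2 2 = -(x.2 0 * v.2 0 + x.2 1 * v.2 1) / x.2 2 := by
      rw [mem_tangent, dGam] at hv
      field_simp
      linear_combination hv / 2
    rw [dK, dH, dL, reK, imK, h₁, k₃, k₄, hv₀, h₀]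
    field_simp
    ring

theorem mem_solutions4_of_steady {a p q τ : ℝ} (hp : p ≠ 0) (hq : q ≠ 0) {x : Phase} (hx : x ∈ P5 a)
    (h₀ : p = x.2 0 * (q ^ 2 - τ ^ 2)) (h₁ : x.1 0 = 2 * τ * x.2 0)
    (h₂ : x.1 1 = 2 * τ * x.2 1 - 2 * q * x.2 2) (h₃ : x.1 2 = τ * x.2 2 + q * x.2 1)
    (h₄ : q * x.2 2 = τ * x.2 1) : x ∈ solutions4 a p q := by
  have hΓ : a ^ 2 = x.2 0 ^ 2 + x.2 1 ^ 2 + x.2 2 ^ 2 := hx.symm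
  have hd : q ^ 2 - τ ^ 2 ≠ 0 := by
    intro h; apply hp; rw [h₀, h]; ring
  have hα : x.2 0 ≠ 0 := by
    intro h; apply hp; rw [h₀, h]; ring
  obtain ⟨r, hr₁, hr₂⟩ : ∃ r, x.2 1 = q * r ∧ x.2 2 = τ * r :=
    ⟨x.2 1 / q, by field_simp, by field_simp; linear_combination h₄⟩
  rw [hr₁, hr₂] at h₂ h₃
  have h₂' : x.1 1 = 0 := by rw [h₂]; ring
  have h₃' : x.1 2 = (q ^ 2 + τ ^ 2) * r := by rw [h₃]; ring
  rw [hr₁, hr₂] at hΓ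
  -- `t = -M₁ / (2p)`, as on the whole fourth subsystem, and `σ = p² t² + q² a²`. The coefficient of
  -- `dL` is `τσ`, so that `dH` and `dL` enter only through `dH - 2τ dL`.
  refine mem_solutions4 hp hx (σ := (q ^ 2 + τ ^ 2) * (x.2 0 ^ 2 + q ^ 2 * r ^ 2))
    (s := (τ ^ 2 - q ^ 2) * (x.2 0 ^ 2 + (q ^ 2 + τ ^ 2) * r ^ 2 / 2)) (t := - τ / (q ^ 2 - τ ^ 2))
    (τ := τ * ((q ^ 2 + τ ^ 2) * (x.2 0 ^ 2 + q ^ 2 * r ^ 2))) ?_ ?_ ?_ ?_ ?_ fun v hv => ?_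
  · rw [H, h₁, h₂', h₃', hr₁, hr₂, hΓ, h₀]
    ring
  · rw [h₀]
    field_simp
    ring
  · rw [L, h₁, h₂', h₃', hr₁, hr₂]
    field_simp
    ring
  · rw [h₀, hΓ]
    field_simp
    ring
  · rw [K, h₁, h₂', h₃', hr₁, hr₂, h₀, hΓ]
    field_simp
    ring
  · rw [mem_tangent, dGam, hr₁, hr₂] at hv
    rw [dK, dH, dL, reK, imK, h₁, h₂', h₃', hr₁, hr₂, h₀]
    linear_combination (q ^ 2 + τ ^ 2) * (x.2 0 ^ 2 + q ^ 2 * r ^ 2) * (q ^ 2 + τ ^ 2) * hv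

theorem exists_solution_of_dH_relation {a p q τ c : ℝ} (ha : a ≠ 0) (hp : p ≠ 0) (hq : q ≠ 0)
    {x : Phase} (hx : x ∈ P5 a)
    (h : ∀ v, dH p q x v - 2 * τ * dL x v + c * dGam x v = 0) : x ∈ allSolutions a p q := by
  have e₁ := h (![1, 0, 0], 0)
  have e₂ := h (![0, 1, 0], 0)
  have e₃ := h (![0, 0, 1], 0)
  have e₄ := h (0, ![1, 0, 0])
  have e₅ := h (0, ![0, 1, 0])
  have e₆ := h (0, ![0, 0, 1])
  simp [dH, dL, dGam] at e₁ e₂ e₃ e₄ e₅ e₆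
  have h₁ : x.1 0 = 2 * τ * x.2 0 := by linear_combination 2 * e₁
  have h₂ : x.1 1 = 2 * τ * x.2 1 - 2 * q * x.2 2 := by linear_combination 2 * e₂
  have h₃ : x.1 2 = τ * x.2 2 + q * x.2 1 := by linear_combination e₃
  have f₀ : p = 2 * x.2 0 * (c - τ ^ 2) := by linear_combination -e₄ - τ * h₁
  have f₁ : x.2 1 * (2 * c - q ^ 2 - 2 * τ ^ 2) + q * τ * x.2 2 = 0 := by
    linear_combination e₅ + q * h₃ + τ * h₂
  have f₂ : q * τ * x.2 1 + x.2 2 * (2 * c - 2 * q ^ 2 - τ ^ 2) = 0 := by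
    linear_combination e₆ - q * h₂ + τ * h₃
  -- Eliminating `c` from `f₁, f₂` leaves a quadratic form in `α₂, α₃` that splits: one factor leads
  -- to the fourth subsystem, the other to the planar family.
  have f₃ : (q * x.2 2 - τ * x.2 1) * (q * x.2 1 + τ * x.2 2) = 0 := by
    linear_combination x.2 2 * f₁ - x.2 1 * f₂
  by_cases hz : x.2 1 = 0 ∧ x.2 2 = 0
  · refine Or.inl (Or.inr (mem_solutions3_of_collinear ha hx ?_ ?_ hz.1 hz.2))
    · rw [h₂, hz.1, hz.2]; ring
    · rw [h₃, hz.1, hz.2]; ring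
  rcases mul_eq_zero.1 f₃ with e | e
  · refine Or.inr (mem_solutions4_of_steady (τ := τ) hp hq hx ?_ h₁ h₂ h₃ (by linear_combination e))
    have hy : x.2 1 ≠ 0 := by
      intro hy
      apply hz
      refine ⟨hy, ?_⟩
      simpa [hy, hq] using e
    have : 2 * c = q ^ 2 + τ ^ 2 := by
      apply mul_left_cancel₀ hy
      linear_combination f₁ - τ * e
    linear_combination f₀ + x.2 0 * this
  · have hy : x.2 2 ≠ 0 := by
      intro hy
      apply hz
      refine ⟨?_, hy⟩
      simpa [hy, hq] using e
    have : 2 * c = 2 * q ^ 2 + 2 * τ ^ 2 := by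
      apply mul_left_cancel₀ hy
      linear_combination f₂ - τ * e
    refine Or.inl (Or.inr (mem_solutions3_of_planar ha hx ?_ ?_ hy ?_ ?_))
    · linear_combination f₀ + x.2 0 * this
    · linear_combination h₃ + e
    · linear_combination x.2 2 * h₁ + 2 * x.2 0 * e
    · linear_combination x.2 2 * h₂ + 2 * x.2 1 * e

theorem exists_solution_of_dK_relation {a p q σ τ c : ℝ} (ha : a ≠ 0) (hp : p ≠ 0) (hq : q ≠ 0)
    {x : Phase} (hx : x ∈ P5 a)
    (h : ∀ v, dK p q x v - 2 * σ * dH p q x v + 4 * τ * dL x v + c * dGam x v = 0) :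
    x ∈ allSolutions a p q := by
  by_cases hK₀ : K p q x = 0
  · exact Or.inl (Or.inl (Or.inl (mem_solutions1 hx hK₀)))
  have hT : ∀ v ∈ tangent x, dK p q x v - 2 * σ * dH p q x v + 4 * τ * dL x v = 0 := by
    intro v hv
    have := h v
    rwa [mem_tangent.1 hv, mul_zero, add_zero] at this
  have e₁ := h (![1, 0, 0], 0)
  have e₂ := h (![0, 1, 0], 0)
  have e₃ := h (![0, 0, 1], 0)
  have e₄ := h (0, ![1, 0, 0])
  have e₅ := h (0, ![0, 1, 0])
  have e₆ := h (0, ![0, 0, 1])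
  simp [dK, dH, dL, dGam] at e₁ e₂ e₃ e₄ e₅ e₆
  have hΓ : x.2 0 ^ 2 + x.2 1 ^ 2 + x.2 2 ^ 2 = a ^ 2 := hx
  have hL : x.1 0 * x.2 0 + x.1 1 * x.2 1 + x.1 2 * x.2 2 = 2 * L x := by rw [L]; ring
  have hH : 2 * (((x.1 0 ^ 2 + x.1 1 ^ 2 + 2 * x.1 2 ^ 2) / 4
      + q * (x.2 2 * x.1 1 - x.2 1 * x.1 2) - p * x.2 0)
      + q ^ 2 * (x.2 0 ^ 2 + x.2 1 ^ 2 + x.2 2 ^ 2)) = 2 * (H p q x + q ^ 2 * a ^ 2) := by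
    rw [H, hΓ]
  obtain ⟨s, hs⟩ : ∃ s, s = H p q x + q ^ 2 * a ^ 2 - σ := ⟨_, rfl⟩
  have hI := Complex.I_sq
  obtain ⟨r₁, r₂, r₃, r₄, r₅, r₆⟩ := complex_relations (F := ℂ) (i := Complex.I) (p := p) (q := q)
    (M₁ := x.1 0) (M₂ := x.1 1) (M₃ := x.1 2) (α₁ := x.2 0) (α₂ := x.2 1) (α₃ := x.2 2)
    (U := reK p q x) (V := imK p q x) (σ := σ) (τ := τ) (c := c)
    hI rfl rfl rfl rfl rfl rfl rfl rfl rfl rfl rfl rfl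
    (by exact_mod_cast (by linear_combination e₁ : (_ : ℝ) = 0))
    (by exact_mod_cast (by linear_combination e₂ : (_ : ℝ) = 0))
    (by exact_mod_cast (by linear_combination e₃ / 2 : (_ : ℝ) = 0))
    (by exact_mod_cast (by linear_combination e₄ / 2 : (_ : ℝ) = 0))
    (by exact_mod_cast (by linear_combination e₅ / 2 : (_ : ℝ) = 0))
    (by exact_mod_cast (by linear_combination e₆ / 2 : (_ : ℝ) = 0))
  obtain ⟨i₁, i₂, i₃, i₄, i₅⟩ := complex_integrals (F := ℂ) (i := Complex.I) (p := p) (q := q)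
    (M₁ := x.1 0) (M₂ := x.1 1) (M₃ := x.1 2) (α₁ := x.2 0) (α₂ := x.2 1) (α₃ := x.2 2)
    hI rfl rfl rfl rfl rfl rfl rfl rfl rfl
  have i₁' : _ = (reK p q x : ℂ) + Complex.I * imK p q x := i₁.trans (by simp [reK, imK])
  have i₂' : _ = (reK p q x : ℂ) - Complex.I * imK p q x := i₂.trans (by simp [reK, imK])
  have i₃' : _ = ((2 * (H p q x + q ^ 2 * a ^ 2) : ℝ) : ℂ) := i₃.trans (by rw [← hH]; push_cast; ring)
  have i₄' : _ = ((2 * L x : ℝ) : ℂ) := i₄.trans (by rw [← hL]; push_cast; ring)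
  have i₅' : _ = ((a ^ 2 : ℝ) : ℂ) := i₅.trans (by rw [← hΓ]; push_cast; ring)
  have hZ : ((reK p q x : ℂ) + Complex.I * imK p q x) * ((reK p q x : ℂ) - Complex.I * imK p q x)
      = (K p q x : ℝ) := by
    rw [K_eq]; push_cast; linear_combination - (imK p q x : ℂ) ^ 2 * hI
  -- In `elimination` the letters `s` and `l` stand for `2s` and `2ℓ`, and `κ² = -q²`. The
  -- equivalences `x = 0 ↔ y = 0` and `W₁ = 0 ↔ W₂ = 0` hold because these pairs are complex
  -- conjugate.
  have := elimination (s := ((2 * s : ℝ) : ℂ)) rfl rfl rfl i₁'.symm i₂'.symm i₅'.symm i₄'.symm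
    (by rw [i₃', hs]; push_cast; ring) r₁ r₂ r₃ r₄ r₅ r₆ (by exact_mod_cast hp)
    (by simp [hq]) (by exact_mod_cast pow_ne_zero 2 ha) (by simp [Complex.ext_iff])
    (by simp [Complex.ext_iff]; intro _; constructor <;> intro _ <;> linarith) (by rw [hZ]; exact_mod_cast hK₀)
  rw [hZ] at this
  clear i₁ i₂ i₃ i₄ i₅ i₁' i₂' i₃' i₄' i₅' hZ r₁ r₂ r₃ r₄ r₅ r₆
  rcases this with h | h | h | h | h
  · obtain ⟨h₁, h₂, h₃⟩ := h
    have h₁' : τ = 0 := by exact_mod_cast h₁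
    have h₂' : p ^ 2 + 2 * q ^ 2 * s = 0 := by
      have : ((p ^ 2 + 2 * q ^ 2 * s : ℝ) : ℂ) = 0 := by
        push_cast at h₂ ⊢
        linear_combination h₂ + 2 * (q : ℂ) ^ 2 * s * hI
      exact_mod_cast this
    have h₃' : K p q x = σ ^ 2 := by exact_mod_cast h₃
    refine Or.inl (Or.inl (Or.inr (mem_solutions2 (σ := σ) hq hx ?_ h₃' fun v hv => ?_)))
    · field_simp
      linear_combination - h₂' + 2 * q ^ 2 * hs
    · have := hT v hv
      rw [h₁'] at this
      linear_combination this
  · obtain ⟨h₁, h₂, h₃⟩ := h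
    have h₁' : a ^ 2 * (2 * s) = (2 * L x) ^ 2 := by exact_mod_cast h₁
    have h₂' : a ^ 2 * τ = σ * (2 * L x) := by exact_mod_cast h₂
    have h₃' : K p q x = σ ^ 2 := by exact_mod_cast h₃
    exact Or.inl (Or.inr (mem_solutions3 ha hx (by rw [← hs]; linear_combination h₁' / 2)
      (by rw [h₂']; ring) h₃' hT))
  -- `W₁ + W₂ = M₁`, which makes this `t` real.
  · obtain ⟨t, ht⟩ : ∃ t, t = - x.1 0 / (2 * p) := ⟨_, rfl⟩
    obtain ⟨h₁, h₂, h₃, h₄⟩ := h t (by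
      rw [ht]
      push_cast
      have : (p : ℂ) ≠ 0 := by exact_mod_cast hp
      field_simp
      ring)
    have hI' : (Complex.I * (q : ℂ)) ^ 2 = -(q : ℂ) ^ 2 := by linear_combination (q : ℂ) ^ 2 * hI
    rw [hI', neg_mul, sub_neg_eq_add] at h₁ h₃ h₄
    have h₁' : τ = (p ^ 2 + q ^ 2 * (2 * s)) * t := by exact_mod_cast h₁
    have h₂' : 2 * L x = t * (2 * s) := by exact_mod_cast h₂
    have h₃' : σ = p ^ 2 * t ^ 2 + q ^ 2 * a ^ 2 := by exact_mod_cast h₃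
    have h₄' : K p q x = σ ^ 2 + (p ^ 2 + q ^ 2 * (2 * s)) * (a ^ 2 - t ^ 2 * (2 * s)) := by
      exact_mod_cast h₄
    exact Or.inr (mem_solutions4 hp hx hs (by rw [h₁']; ring) (by linear_combination h₂' / 2) h₃'
      (by rw [h₄']; ring) hT)
  · obtain ⟨h₁, h₂, h₃, h₄⟩ := h
    have k₁ : x.2 1 = 0 := by
      have := congrArg Complex.im h₁
      simp at this
      linarith
    have k₂ : x.2 2 = 0 := by exact_mod_cast h₂
    have k₃ : x.1 2 = 0 := by exact_mod_cast h₃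
    have k₄ : x.1 1 / 2 + q * x.2 2 = 0 := by
      have := congrArg Complex.im h₄
      simp at this
      linarith
    exact Or.inl (Or.inr (mem_solutions3_of_collinear ha hx (by rw [k₂] at k₄; linarith) k₃ k₁ k₂))
  · obtain ⟨h₁, h₂, h₃, h₄, -⟩ := h
    have k₁ : p = 2 * q ^ 2 * x.2 0 := by
      have := congrArg Complex.re h₁
      simp [pow_two] at this
      linarith
    have k₂ : x.1 2 = 0 := by exact_mod_cast h₂
    have k₃ : x.2 2 ≠ 0 := by exact_mod_cast h₃
    have k₄ := congrArg Complex.re h₄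
    have k₅ := congrArg Complex.im h₄
    simp at k₄ k₅
    exact Or.inl (Or.inr (mem_solutions3_of_planar ha hx k₁ k₂ k₃ (by linarith) (by linarith)))

theorem criticalSet_subset {a p q : ℝ} (ha : a ≠ 0) (hp : p ≠ 0) (hq : q ≠ 0) :
    criticalSet a p q ⊆ allSolutions a p q := by
  intro x hx
  obtain ⟨c₀, c₁, c₂, c₃, hc, h⟩ := exists_relation ha hx
  by_cases h₀ : c₀ = 0
  · subst h₀
    by_cases h₁ : c₁ = 0
    · subst h₁
      exfalso
      -- `dΓ` has no `M`-components and those of `dL` are `α / 2`, so `α = 0`, contrary to `a ≠ 0`.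
      have h₂ : c₂ ≠ 0 := by simpa using hc
      have e₁ := h (![1, 0, 0], 0)
      have e₂ := h (![0, 1, 0], 0)
      have e₃ := h (![0, 0, 1], 0)
      simp [dL, dGam, h₂] at e₁ e₂ e₃
      apply ha
      have : a ^ 2 = x.2 0 ^ 2 + x.2 1 ^ 2 + x.2 2 ^ 2 := hx.1.symm
      simpa [e₁, e₂, e₃] using this
    · refine exists_solution_of_dH_relation (τ := - c₂ / (2 * c₁)) (c := c₃ / c₁) ha hp hq hx.1
        fun v => ?_
      have := h v
      field_simp
      linear_combination this
  · refine exists_solution_of_dK_relation (σ := - c₁ / (2 * c₀)) (τ := c₂ / (4 * c₀))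
      (c := c₃ / c₀) ha hp hq hx.1 fun v => ?_
    have := h v
    field_simp
    linear_combination this

/-! ### Multiple roots of `S` and the discriminant set. -/

theorem two_le_rootMultiplicity_mul_iff {R : Type*} [CommRing R] [IsDomain R] [CharZero R]
    {P Q : R[X]} (hP : P ≠ 0) (hQ : Q ≠ 0) (z : R) :
    2 ≤ (P * Q).rootMultiplicity z ↔
      (P.eval z = 0 ∧ Q.eval z = 0) ∨ (P.eval z = 0 ∧ P.derivative.eval z = 0) ∨
        (Q.eval z = 0 ∧ Q.derivative.eval z = 0) := by
  rw [show 2 ≤ (P * Q).rootMultiplicity z ↔ 1 < (P * Q).rootMultiplicity z from Iff.rfl,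
    one_lt_rootMultiplicity_iff_isRoot (mul_ne_zero hP hQ)]
  simp only [IsRoot, eval_mul, derivative_mul, eval_add, mul_eq_zero]
  constructor
  · rintro ⟨h₁ | h₁, h₂⟩
    · rw [h₁, zero_mul, add_zero, mul_eq_zero] at h₂
      rcases h₂ with h₂ | h₂ <;> simp [h₁, h₂]
    · rw [h₁, mul_zero, zero_add, mul_eq_zero] at h₂
      rcases h₂ with h₂ | h₂ <;> simp [h₁, h₂]
  · rintro (h | h | h) <;> simp [h.1, h.2]

theorem polyP_ne_zero (a q h k : ℝ) : polyP a q h k ≠ 0 := by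
  intro e
  have e₀ := congrArg (eval (h + q ^ 2 * a ^ 2)) e
  have e₁ := congrArg (eval (h + q ^ 2 * a ^ 2 + 1)) e
  simp only [polyP, eval_sub, eval_pow, eval_X, eval_C, eval_zero] at e₀ e₁
  linarith

theorem polyPhi_ne_zero (a p q h l k : ℝ) : polyPhi a p q h l k ≠ 0 := by
  intro e
  have e₀ := congrArg (eval 0) e
  have e₁ := congrArg (eval 1) e
  have e₂ := congrArg (eval 2) e
  have e₃ := congrArg (eval 3) e
  simp only [polyPhi, eval_sub, eval_add, eval_mul, eval_pow, eval_X, eval_C, eval_zero]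
    at e₀ e₁ e₂ e₃
  linarith

theorem mem_discriminantSet_iff {a p q h l k : ℝ} :
    (h, l, k) ∈ discriminantSet a p q ↔ ∃ z : ℂ,
      ((z - (h + q ^ 2 * a ^ 2)) ^ 2 - k = 0 ∧
        z ^ 3 - 2 * h * z ^ 2 + ((h + q ^ 2 * a ^ 2) ^ 2 + a ^ 2 * p ^ 2 - 4 * q ^ 2 * l ^ 2 - k) * z
          - 2 * p ^ 2 * l ^ 2 = 0) ∨
      ((z - (h + q ^ 2 * a ^ 2)) ^ 2 - k = 0 ∧ 2 * (z - (h + q ^ 2 * a ^ 2)) = 0) ∨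
      (z ^ 3 - 2 * h * z ^ 2 + ((h + q ^ 2 * a ^ 2) ^ 2 + a ^ 2 * p ^ 2 - 4 * q ^ 2 * l ^ 2 - k) * z
          - 2 * p ^ 2 * l ^ 2 = 0 ∧
        3 * z ^ 2 - 2 * h * (2 * z) + ((h + q ^ 2 * a ^ 2) ^ 2 + a ^ 2 * p ^ 2 - 4 * q ^ 2 * l ^ 2 - k)
          = 0) := by
  refine exists_congr fun z => ?_
  rw [polyS, Polynomial.map_mul, two_le_rootMultiplicity_mul_iff
    (Polynomial.map_ne_zero (polyP_ne_zero _ _ _ _))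
    (Polynomial.map_ne_zero (polyPhi_ne_zero _ _ _ _ _ _))]
  simp [polyP, polyPhi, derivative_pow]

/-- A real cubic polynomial has only real double roots. -/
theorem im_eq_zero_of_double_root {b c d : ℝ} {z : ℂ} (h₀ : z ^ 3 + b * z ^ 2 + c * z + d = 0)
    (h₁ : 3 * z ^ 2 + 2 * b * z + c = 0) : z.im = 0 := by
  have e₀ := congrArg Complex.im h₀
  have e₁ := congrArg Complex.im h₁
  have e₂ := congrArg Complex.re h₁
  simp [pow_succ] at e₀ e₁ e₂
  by_contra hv
  have f₁ : b = -3 * z.re := by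
    apply mul_left_cancel₀ hv
    linear_combination e₁ / 2
  have f₂ : c = 3 * z.re ^ 2 + 3 * z.im ^ 2 := by
    rw [f₁] at e₂
    linear_combination e₂
  apply hv
  rw [f₁, f₂] at e₀
  have : z.im ^ 3 = 0 := by linear_combination e₀ / 2
  simpa using this

theorem discriminantSet_eq {a p q : ℝ} (ha : a ≠ 0) (hp : p ≠ 0) (hq : q ≠ 0) :
    discriminantSet a p q = Pi1 ∪ Pi2 a p q ∪ Pi3 a q ∪ Pi4 a p q := by
  ext ⟨h, l, k⟩
  rw [mem_discriminantSet_iff]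
  simp only [Set.mem_union, Pi1, Pi2, Pi3, Pi4, k4, Set.mem_ofPred_eq]
  constructor
  · rintro ⟨z, ⟨e₁, e₂⟩ | ⟨e₁, e₂⟩ | ⟨e₁, e₂⟩⟩
    -- This is `φ(z) - z P(z)`, in which `k` cancels.
    · have e₃ : (2 * q ^ 2 * z + p ^ 2) * (a ^ 2 * z - 2 * l ^ 2) = 0 := by
        linear_combination e₂ - z * e₁
      have hq' : (q : ℂ) ≠ 0 := by exact_mod_cast hq
      have ha' : (a : ℂ) ≠ 0 := by exact_mod_cast ha
      rcases mul_eq_zero.1 e₃ with e | e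
      · have hz : z = ((- p ^ 2 / (2 * q ^ 2) : ℝ) : ℂ) := by
          push_cast
          field_simp
          linear_combination e
        rw [hz] at e₁
        have e₁' : (- p ^ 2 / (2 * q ^ 2) - (h + q ^ 2 * a ^ 2)) ^ 2 - k = 0 := by exact_mod_cast e₁
        left; left; right
        rw [← sub_eq_zero.1 e₁']
        field_simp
        ring
      · have hz : z = ((2 * l ^ 2 / a ^ 2 : ℝ) : ℂ) := by
          push_cast
          field_simp
          linear_combination e
        rw [hz] at e₁
        have e₁' : (2 * l ^ 2 / a ^ 2 - (h + q ^ 2 * a ^ 2)) ^ 2 - k = 0 := by exact_mod_cast e₁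
        left; right
        rw [← sub_eq_zero.1 e₁']
        field_simp
        ring
    · left; left; left
      have : (k : ℂ) = 0 := by linear_combination - e₁ + (z - (h + q ^ 2 * a ^ 2)) / 2 * e₂
      exact_mod_cast this
    · right
      have hz := im_eq_zero_of_double_root (z := z) (b := -2 * h)
        (c := (h + q ^ 2 * a ^ 2) ^ 2 + a ^ 2 * p ^ 2 - 4 * q ^ 2 * l ^ 2 - k)
        (d := - 2 * p ^ 2 * l ^ 2) (by push_cast; linear_combination e₁)
        (by push_cast; linear_combination e₂)
      obtain ⟨s, rfl⟩ : ∃ s : ℝ, z = s := ⟨z.re, Complex.ext rfl (by simpa using hz)⟩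
      have e₁' : s ^ 3 - 2 * h * s ^ 2 + ((h + q ^ 2 * a ^ 2) ^ 2 + a ^ 2 * p ^ 2 - 4 * q ^ 2 * l ^ 2
        - k) * s - 2 * p ^ 2 * l ^ 2 = 0 := by exact_mod_cast e₁
      have e₂' : 3 * s ^ 2 - 2 * h * (2 * s) + ((h + q ^ 2 * a ^ 2) ^ 2 + a ^ 2 * p ^ 2 - 4 * q ^ 2 * l ^ 2
        - k) = 0 := by exact_mod_cast e₂
      -- `s φ'(s) - φ(s)` does not contain `k` and gives `ℓ²`; then `φ'(s) = 0` gives `k`.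
      have f : l ^ 2 = 1 / p ^ 2 * (h - s) * s ^ 2 := by
        field_simp
        linear_combination (- e₁' + s * e₂') / 2
      refine ⟨s, f, ?_⟩
      rw [f] at e₂'
      field_simp at e₂' ⊢
      linear_combination -e₂'
  · rintro (((e | e) | e) | ⟨s, e, e'⟩)
    · refine ⟨((h + q ^ 2 * a ^ 2 : ℝ) : ℂ), Or.inr (Or.inl ?_)⟩
      constructor <;> simp [e]
    · refine ⟨((- p ^ 2 / (2 * q ^ 2) : ℝ) : ℂ), Or.inl ⟨?_, ?_⟩⟩ <;> norm_cast <;> rw [e] <;>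
        field_simp <;> ring
    · refine ⟨((2 * l ^ 2 / a ^ 2 : ℝ) : ℂ), Or.inl ⟨?_, ?_⟩⟩ <;> norm_cast <;> rw [e] <;>
        field_simp <;> ring
    · refine ⟨(s : ℂ), Or.inr (Or.inr ⟨?_, ?_⟩)⟩ <;> norm_cast <;> rw [e', e] <;>
        field_simp <;> ring

/-! ### The bifurcation diagram and the final statement. -/

theorem bifurcationDiagram_eq {a p q : ℝ} (ha : a ≠ 0) (hp : p ≠ 0) (hq : q ≠ 0) :
    bifurcationDiagram a p q =
      realPart1 a p q ∪ realPart2 a p q ∪ realPart3 a p q ∪ realPart4 a p q := by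
  apply Set.Subset.antisymm
  · rintro _ ⟨x, hx, rfl⟩
    rcases criticalSet_subset ha hp hq hx with ((h | h) | h) | h
    · exact Or.inl (Or.inl (Or.inl ⟨h.2.1, x, h, rfl⟩))
    · exact Or.inl (Or.inl (Or.inr ⟨sub_eq_zero.1 h.2.1, x, h, rfl⟩))
    · exact Or.inl (Or.inr ⟨sub_eq_zero.1 h.2.1, x, h, rfl⟩)
    · refine Or.inr ⟨?_, x, h, rfl⟩
      obtain ⟨-, s, t, hL, hH, hK, -⟩ := h
      refine ⟨s, ?_, hK⟩
      simp only [momentum]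
      rw [hL, hH]
      field_simp
  · rintro _ (((⟨-, x, h, rfl⟩ | ⟨-, x, h, rfl⟩) | ⟨-, x, h, rfl⟩) | ⟨-, x, h, rfl⟩)
    · exact ⟨x, solutions1_subset h, rfl⟩
    · exact ⟨x, solutions2_subset hq h, rfl⟩
    · exact ⟨x, solutions3_subset ha h, rfl⟩
    · exact ⟨x, solutions4_subset h, rfl⟩

end KowalevskiSokolov

end

theorem theorem1 (a ε₀ ε₁ : ℝ) (ha : 0 < a) (hε₀ : 0 < ε₀) (hε₁ : 0 < ε₁) :
    KowalevskiSokolov.discriminantSet a ε₀ ε₁ =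
        KowalevskiSokolov.Pi1 ∪ KowalevskiSokolov.Pi2 a ε₀ ε₁ ∪ KowalevskiSokolov.Pi3 a ε₁
          ∪ KowalevskiSokolov.Pi4 a ε₀ ε₁ ∧
      KowalevskiSokolov.bifurcationDiagram a ε₀ ε₁ ⊆
        KowalevskiSokolov.discriminantSet a ε₀ ε₁ ∧
      KowalevskiSokolov.bifurcationDiagram a ε₀ ε₁ =
        KowalevskiSokolov.realPart1 a ε₀ ε₁ ∪ KowalevskiSokolov.realPart2 a ε₀ ε₁
          ∪ KowalevskiSokolov.realPart3 a ε₀ ε₁ ∪ KowalevskiSokolov.realPart4 a ε₀ ε₁ := by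
  have hD := KowalevskiSokolov.discriminantSet_eq ha.ne' hε₀.ne' hε₁.ne'
  have hB := KowalevskiSokolov.bifurcationDiagram_eq ha.ne' hε₀.ne' hε₁.ne'
  refine ⟨hD, ?_, hB⟩
  rw [hB, hD]
  exact Set.union_subset_union (Set.union_subset_union (Set.union_subset_union
    (Set.sep_subset _ _) (Set.sep_subset _ _)) (Set.sep_subset _ _)) (Set.sep_subset _ _)
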